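/- Let $(X_t,(\mathbb P_x)_{x\in E})$ be a conservative, time-homogeneous, measurable Markov process in continuous time on a Polish space $E$, with semigroup $(P_t)_{t\ge 0}$, and let $\mu$ be an invariant probability measure. Let $L$, with domain $D(L)$, be the generator of $(P_t)$ in $\mathbb L^2(\mu)$, and write $\langle f,g\rangle_\mu=\int fg\,d\mu$ and $\mathbb P_\nu=\int\mathbb P_x\,\nu(dx)$. Let $F$ be a real function on $]0,+\infty[$ that is continuous, increasing and concave, with $F(x)\to+\infty$ as $x\to+\infty$, $F(1)=0$ and $F(xy)\le F(x)+F(y)$ for all $x,y>0$. Put $F(0)=\lim_{x\downarrow 0}F(x)\in[-\infty,0[$ and $F(+\infty)=+\infty$, and let $F^{-1}:\,]F(0),+\infty[\,\to\,]0,+\infty[$ be the inverse function. Assume that $\mu$ satisfies the $F$-Sobolev inequality $$\int f^2F(f^2)\,d\mu\le-\langle Lf,f\rangle_\mu\qquad\text{for all } f\in D(L)\text{ with }\int f^2d\mu=1,$$ the left-hand integral being, in particular, finite. Let $V\in\mathbb L^1(\mu)$. For a $\mu$-integrable function $W$ let $\lambda_W\in[0,+\infty]$ be the largest number such that $\lambda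 W>F(0)$ $\mu$-a.e. for all $0\le\lambda<\lambda_W$, and put $$H^*_W(a)=\sup_{0\le\lambda<\lambda_W}\Big\{\lambda a-F\Big(\int F^{-1}(\lambda W)\,d\mu\Big)\Big\}\in[-\infty,+\infty],\qquad H^*=H^*_V,\qquad H^*_c=H^*_{V-\int V d\mu}.$$ (i) For every probability measure $\nu\ll\mu$, all $t>0$ and all $R>0$, $$\mathbb P_\nu\Big(\frac1t\int_0^tV(X_s)\,ds-\int V\,d\mu\ge R\Big)\le\Big\|\frac{d\nu}{d\mu}\Big\|_{\mathbb L^2(\mu)}\exp\Big(-t\,H^*\Big(R+\int V\,d\mu\Big)\Big)$$ and $$\mathbb P_\nu\Big(\frac1t\int_0^tV(X_s)\,ds-\int V\,d\mu\ge R\Big)\le\Big\|\frac{d\nu}{d\mu}\Big\|_{\mathbb L^2(\mu)}\exp\big(-t\,H_c^*(R)\big).$$ (ii) If $F(0)=-\infty$, the second bound is at least as good as the first: $H^*(R+\int V\,d\mu)\le H^*_c(R)$ for all $R>0$. (iii) For all $0\le\lambda<\lambda_V$, $$\Lambda(\lambda V):=\sup\Big\{\int\lambda Vf^2\,d\mu+\langle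 Lf,f\rangle_\mu\;;\;f\in D(L),\ \int f^2d\mu=1\Big\}\le F\Big(\int F^{-1}(\lambda V)\,d\mu\Big).$$ -/

import Mathlib

open MeasureTheory ProbabilityTheory Filter Topology Set
open scoped NNReal ENNReal

noncomputable section

/-- A conservative, time-homogeneous Markov process `(X_t, (ℙ_x)_{x ∈ E})` in continuous time,
with state space `E`, realised on a measurable space `Ω`. The process is jointly measurable in
`(t, ω)`, so that the time integrals `∫₀ᵗ V (X_s) ds` make sense. -/
structure MarkovProcess (E Ω : Type*) [MeasurableSpace E] [MeasurableSpace Ω] where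
  /-- the process `X_t` -/
  X : ℝ≥0 → Ω → E
  /-- the laws `ℙ_x` -/
  law : Kernel E Ω
  /-- each `ℙ_x` is a probability measure -/
  isMarkovKernel : IsMarkovKernel law
  measurable_X : Measurable fun p : ℝ≥0 × Ω => X p.1 p.2
  /-- under `ℙ_x` the process starts from `x` -/
  start : ∀ x, ∀ᵐ ω ∂(law x), X 0 ω = x
  /-- the Markov property with respect to the natural filtration:
  `ℙ_x (X_{s+t} ∈ B | σ(X_u, u ≤ s)) = ℙ_{X_s} (X_t ∈ B)` -/
  markov : ∀ (x : E) (s t : ℝ≥0) (A : Set Ω),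
    MeasurableSet[⨆ u : {u : ℝ≥0 // u ≤ s}, MeasurableSpace.comap (X u) inferInstance] A →
    ∀ B : Set E, MeasurableSet B →
      law x (A ∩ X (s + t) ⁻¹' B) = ∫⁻ ω in A, law (X s ω) (X t ⁻¹' B) ∂(law x)

namespace MarkovProcess

variable {E Ω : Type*} [MeasurableSpace E] [MeasurableSpace Ω]

/-- The law `ℙ_ν = ∫ ℙ_x ν(dx)` of the process with initial distribution `ν`. -/
def initLaw (M : MarkovProcess E Ω) (ν : Measure E) : Measure Ω :=
  ν.bind M.law

/-- The transition kernel `P_t(x, dy) = ℙ_x (X_t ∈ dy)`. -/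
def transition (M : MarkovProcess E Ω) (t : ℝ≥0) : Kernel E E :=
  M.law.map (M.X t)

/-- The semigroup `P_t f (x) = 𝔼_x [f (X_t)]`. -/
def semigroup (M : MarkovProcess E Ω) (t : ℝ≥0) (f : E → ℝ) (x : E) : ℝ :=
  ∫ y, f y ∂(M.transition t x)

/-- `μ` is invariant for the semigroup: `μ P_t = μ` for all `t`. -/
def IsInvariant (M : MarkovProcess E Ω) (μ : Measure E) : Prop :=
  ∀ t : ℝ≥0, (M.transition t).Invariant μ

/-- `f ∈ D(L)` and `L f = g`, where `L` is the infinitesimal generator of `(P_t)` in `𝕃²(μ)`: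
`f, g ∈ 𝕃²(μ)` and `(P_t f - f) / t → g` in `𝕃²(μ)` as `t ↓ 0`. -/
def HasGenerator (M : MarkovProcess E Ω) (μ : Measure E) (f g : E → ℝ) : Prop :=
  MemLp f 2 μ ∧ MemLp g 2 μ ∧
    Tendsto
      (fun t : ℝ≥0 => eLpNorm (fun x => (M.semigroup t f x - f x) / (t : ℝ) - g x) 2 μ)
      (𝓝[>] 0) (𝓝 0)

/-- The `F`-Sobolev inequality `∫ f² F(f²) dμ ≤ - ⟨L f, f⟩_μ` for all `f ∈ D(L)` with
`∫ f² dμ = 1`. The left-hand side has to be finite; this is the integrability clause. -/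
def FSobolev (M : MarkovProcess E Ω) (μ : Measure E) (F : ℝ → ℝ) : Prop :=
  ∀ f g : E → ℝ, M.HasGenerator μ f g → ∫ x, f x ^ 2 ∂μ = 1 →
    Integrable (fun x => f x ^ 2 * F (f x ^ 2)) μ ∧
      ∫ x, f x ^ 2 * F (f x ^ 2) ∂μ ≤ - ∫ x, g x * f x ∂μ

/-- `Λ(W) = sup { ∫ W f² dμ + ⟨L f, f⟩_μ ; f ∈ D(L), ∫ f² dμ = 1 }`, with values in `[-∞, +∞]`;
the first integral is the difference of the integrals of the positive and negative parts. -/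
def Lam (M : MarkovProcess E Ω) (μ : Measure E) (W : E → ℝ) : EReal :=
  sSup {r : EReal | ∃ f g : E → ℝ, M.HasGenerator μ f g ∧ ∫ x, f x ^ 2 ∂μ = 1 ∧
    r = (((∫⁻ x, ENNReal.ofReal (W x * f x ^ 2) ∂μ : ℝ≥0∞) : EReal)
          - ((∫⁻ x, ENNReal.ofReal (-(W x * f x ^ 2)) ∂μ : ℝ≥0∞) : EReal))
        + ((∫ x, g x * f x ∂μ : ℝ) : EReal)}

/-- The time average `(1/t) ∫₀ᵗ V(X_s) ds`. -/
def timeAverage (M : MarkovProcess E Ω) (V : E → ℝ) (t : ℝ) (ω : Ω) : ℝ :=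
  (1 / t) * ∫ s in (0 : ℝ)..t, V (M.X s.toNNReal ω)

end MarkovProcess

/-- `F(0) = lim_{x ↓ 0} F(x) = inf_{x > 0} F(x) ∈ [-∞, +∞)` for an increasing function `F`
on `]0, +∞[`. -/
def valueAtZero (F : ℝ → ℝ) : EReal :=
  ⨅ x : Ioi (0 : ℝ), ((F x : ℝ) : EReal)

/-- The continuous extension of an increasing `F` that tends to `+∞`, to `[0, +∞]`. -/
def extendF (F : ℝ → ℝ) (y : ℝ≥0∞) : EReal :=
  if y = 0 then valueAtZero F else if y = ∞ then ⊤ else ((F y.toReal : ℝ) : EReal)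

/-- The inverse `F⁻¹ : ]F(0), +∞[ → ]0, +∞[` of `F` (arbitrary outside of `]F(0), +∞[`). -/
def inverseF (F : ℝ → ℝ) : ℝ → ℝ :=
  Function.invFunOn F (Ioi 0)

section

variable {E : Type*} [MeasurableSpace E]

/-- `F (∫ F⁻¹(W) dμ)`, with value `+∞` when `F⁻¹(W)` is not integrable. -/
def sobolevFunctional (μ : Measure E) (F : ℝ → ℝ) (W : E → ℝ) : EReal :=
  extendF F (∫⁻ x, ENNReal.ofReal (inverseF F (W x)) ∂μ)

/-- `λ_V ∈ [0, +∞]`: the largest `ℓ` such that `λ V > F(0)` (`μ`-a.e.) for all `0 ≤ λ < ℓ`. -/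
def lambdaMax (μ : Measure E) (F : ℝ → ℝ) (V : E → ℝ) : EReal :=
  sSup {l : EReal | ∀ c : ℝ, 0 ≤ c → (c : EReal) < l →
    ∀ᵐ x ∂μ, valueAtZero F < ((c * V x : ℝ) : EReal)}

/-- `H*(a) = sup_{0 ≤ λ < λ_V} (λ a - F (∫ F⁻¹(λ V) dμ)) ∈ [-∞, +∞]`. -/
def Hstar (μ : Measure E) (F : ℝ → ℝ) (V : E → ℝ) (a : ℝ) : EReal :=
  ⨆ (c : ℝ) (_ : 0 ≤ c ∧ (c : EReal) < lambdaMax μ F V),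
    ((c * a : ℝ) : EReal) - sobolevFunctional μ F (fun x => c * V x)

/-- `H_c*`: the function `H*` of the centred function `V - ∫ V dμ`. -/
def HstarC (μ : Measure E) (F : ℝ → ℝ) (V : E → ℝ) (a : ℝ) : EReal :=
  Hstar μ F (fun x => V x - ∫ y, V y ∂μ) a

/-- `‖dν/dμ‖` in `𝕃²(μ)`. -/
def densityNorm (ν μ : Measure E) : ℝ≥0∞ :=
  eLpNorm (fun x => (ν.rnDeriv μ x).toReal) 2 μ

end

end

/-! The hypotheses leave little freedom: `F` must be `k * log` with `k > 0` (`exists_eq_mul_log`).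
Concavity puts `F` below a line `k (x - 1)`, and subadditivity gives `F (exp u) ≤ n F (exp (u /
n))`, which in the limit is at most `k u`; applying this to `u` and `-u` forces equality. Hence
`F(0) = -∞`, `λ_V = +∞`, `F⁻¹(y) = exp (y / k)`, and the hypothesis is a logarithmic Sobolev
inequality. Subtracting a constant from `V` shifts `k log ∫ exp (λ V / k) dμ` linearly, so the two
rate functions coincide (`HstarC_eq_Hstar`).

The bound on `Λ` is the duality between entropy and the log-Laplace transform, in the pointwise form
`mul_le_mul_log_add`, integrated with `s = f²`.

The deviation bounds rest on `u_t(x) = 𝔼_x exp ∫₀ᵗ W(X_s) ds`. For bounded `W ≥ 0`, `u_t` lies in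
`D(L)` with `L u_t = ∂_t u_t - W u_t` (`hasGenerator_feynmanKac`), so that `d/dt ‖u_t‖² = 2 (⟨L u_t,
u_t⟩ + ⟨W u_t, u_t⟩) ≤ 2 S ‖u_t‖²`, where `S` bounds the quadratic form; Grönwall yields `‖u_t‖ ≤
exp (t S)`. Paths are only measurable: stationarity and `L¹`-continuity of translations replace
their continuity. Cauchy–Schwarz brings in `‖dν/dμ‖`, an additive constant and truncation remove the
restrictions on `W`, and Markov's inequality optimised over `λ` finishes. -/

/-! ### Powers of a primitive as iterated integrals. -/

theorem AbsolutelyContinuousOnInterval.pow_succ {f : ℝ → ℝ} {a b : ℝ}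
    (hf : AbsolutelyContinuousOnInterval f a b) (n : ℕ) :
    AbsolutelyContinuousOnInterval (fun x => f x ^ (n + 1)) a b := by
  induction n with
  | zero => simpa using hf
  | succ n ih =>
    have := ih.fun_mul hf
    simpa only [← _root_.pow_succ] using this

/-- The integrand is, up to sign and factorial, the a.e. derivative of the `(n + 1)`-st power of the
primitive. Since `w` is only integrable, the fundamental theorem of calculus for absolutely
continuous functions is used. Basing the primitive at `b` produces the signs `(-1) ^ n`. -/
theorem integral_mul_integral_pow {w : ℝ → ℝ} {a b : ℝ} (hw : IntervalIntegrable w volume a b)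
    (n : ℕ) :
    ∫ r in a..b, w r * ((∫ s in r..b, w s) ^ n / n.factorial) =
      (∫ s in a..b, w s) ^ (n + 1) / (n + 1).factorial := by
  set G : ℝ → ℝ := fun r => ∫ s in b..r, w s with hG
  have hGac : AbsolutelyContinuousOnInterval G a b :=
    hw.absolutelyContinuousOnInterval_intervalIntegral (by simp)
  have hInt := (hGac.pow_succ n).integral_deriv_eq_sub
  have hcongr : ∫ r in a..b, deriv (fun x => G x ^ (n + 1)) r =
      ∫ r in a..b, ((-1) ^ n * (n + 1).factorial) *
        (w r * ((∫ s in r..b, w s) ^ n / n.factorial)) := by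
    apply intervalIntegral.integral_congr_ae
    filter_upwards [hw.ae_hasDerivAt_integral] with r hr hrm
    have h1 : HasDerivAt G (w r) r := hr (uIoc_subset_uIcc hrm) b (by simp)
    rw [(h1.fun_pow (n + 1)).deriv]
    have h2 : G r = -∫ s in r..b, w s := intervalIntegral.integral_symm _ _
    have h3 : (n.factorial : ℝ) ≠ 0 := by positivity
    rw [h2, Nat.factorial_succ, neg_pow]
    push_cast
    field_simp
  rw [hcongr, intervalIntegral.integral_const_mul] at hInt
  have h2 : G a = -∫ s in a..b, w s := intervalIntegral.integral_symm _ _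
  have h3 : G b = 0 := by simp [hG]
  have h4 : ((n + 1).factorial : ℝ) ≠ 0 := by positivity
  have h5 : ((-1 : ℝ) ^ n) * (-1) ^ n = 1 := by rw [← mul_pow]; simp
  rw [h2, h3, neg_pow (∫ s in a..b, w s), zero_pow (Nat.succ_ne_zero n),
    _root_.pow_succ (-1 : ℝ) n] at hInt
  rw [eq_div_iff h4]
  linear_combination (-1 : ℝ) ^ n * hInt + (-(n + 1).factorial *
    (∫ r in a..b, w r * ((∫ s in r..b, w s) ^ n / n.factorial)) +
      (∫ s in a..b, w s) ^ (n + 1)) * h5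

/-! ### The Markov property for exponentials of additive functionals. -/

namespace MarkovProcess

variable {E Ω : Type*} [MeasurableSpace E] [MeasurableSpace Ω]

/-- The additive functional `∫ₐᵇ W (X_s) ds`. -/
noncomputable def pathIntegral (M : MarkovProcess E Ω) (W : E → ℝ) (a b : ℝ) (ω : Ω) : ℝ :=
  ∫ s in a..b, W (M.X s.toNNReal ω)

/-- The `σ`-algebra generated by the process up to time `s`. -/
@[reducible]
def past (M : MarkovProcess E Ω) (s : ℝ≥0) : MeasurableSpace Ω :=
  ⨆ u : {u : ℝ≥0 // u ≤ s}, MeasurableSpace.comap (M.X u) inferInstance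

variable (M : MarkovProcess E Ω)

instance : IsMarkovKernel M.law := M.isMarkovKernel

theorem measurable_eval (s : ℝ≥0) : Measurable (M.X s) :=
  M.measurable_X.comp measurable_prodMk_left

theorem measurable_path {W : E → ℝ} (hW : Measurable W) :
    Measurable fun p : ℝ × Ω => W (M.X p.1.toNNReal p.2) := by
  have : Measurable fun p : ℝ × Ω => ((p.1.toNNReal, p.2) : ℝ≥0 × Ω) := by fun_prop
  exact hW.comp (M.measurable_X.comp this)

theorem past_le (s : ℝ≥0) : M.past s ≤ ‹MeasurableSpace Ω› :=
  iSup_le fun u => (M.measurable_eval u).comap_le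

theorem past_mono {s t : ℝ≥0} (h : s ≤ t) : M.past s ≤ M.past t :=
  iSup_le fun u => le_iSup (fun u : {u : ℝ≥0 // u ≤ t} =>
    MeasurableSpace.comap (M.X u) inferInstance) ⟨u.1, u.2.trans h⟩

theorem measurable_eval_past (s : ℝ≥0) : Measurable[M.past s] (M.X s) := by
  have : MeasurableSpace.comap (M.X s) inferInstance ≤ M.past s :=
    le_iSup (fun u : {u : ℝ≥0 // u ≤ s} =>
      MeasurableSpace.comap (M.X u) inferInstance) ⟨s, le_rfl⟩
  exact (comap_measurable (M.X s)).mono this le_rfl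

instance (t : ℝ≥0) : IsMarkovKernel (M.transition t) :=
  Kernel.IsMarkovKernel.map _ (M.measurable_eval t)

theorem lintegral_transition (t : ℝ≥0) (x : E) {φ : E → ℝ≥0∞} (hφ : Measurable φ) :
    ∫⁻ y, φ y ∂(M.transition t x) = ∫⁻ ω, φ (M.X t ω) ∂(M.law x) := by
  rw [transition, Kernel.map_apply _ (M.measurable_eval t),
    lintegral_map hφ (M.measurable_eval t)]

theorem markov_restrict (x : E) (s t : ℝ≥0) {A : Set Ω} (hA : MeasurableSet[M.past s] A)
    {φ : E → ℝ≥0∞} (hφ : Measurable φ) :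
    ∫⁻ ω in A, φ (M.X (s + t) ω) ∂(M.law x) =
      ∫⁻ ω in A, ∫⁻ y, φ y ∂(M.transition t (M.X s ω)) ∂(M.law x) := by
  have hA' : MeasurableSet A := M.past_le s _ hA
  have hmeas : ((M.law x).restrict A).map (M.X (s + t)) =
      (((M.law x).restrict A).map (M.X s)).bind (M.transition t) := by
    ext B hB
    rw [Measure.map_apply (M.measurable_eval _) hB,
      Measure.restrict_apply (M.measurable_eval _ hB),
      Measure.bind_apply hB (Kernel.aemeasurable _),
      lintegral_map (Kernel.measurable_coe _ hB) (M.measurable_eval _), inter_comm,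
      M.markov x s t A hA B hB]
    refine lintegral_congr fun ω => ?_
    rw [transition, Kernel.map_apply' _ (M.measurable_eval t) _ hB]
  rw [← lintegral_map hφ (M.measurable_eval _), hmeas,
    Measure.lintegral_bind (Kernel.aemeasurable _) hφ.aemeasurable,
    lintegral_map (Measurable.lintegral_kernel hφ) (M.measurable_eval _)]

/-- The two densities `φ(X_{s+t})` and `P_t φ(X_s)` define measures that agree on `past s`, hence
integrate every `past s`-measurable weight alike. -/
theorem markov_lintegral (x : E) (s t : ℝ≥0) {g : Ω → ℝ≥0∞} (hg : Measurable[M.past s] g)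
    {φ : E → ℝ≥0∞} (hφ : Measurable φ) :
    ∫⁻ ω, g ω * φ (M.X (s + t) ω) ∂(M.law x) =
      ∫⁻ ω, g ω * ∫⁻ y, φ y ∂(M.transition t (M.X s ω)) ∂(M.law x) := by
  have hφ1 : Measurable fun ω => φ (M.X (s + t) ω) := hφ.comp (M.measurable_eval _)
  have hφ2 : Measurable fun ω => ∫⁻ y, φ y ∂(M.transition t (M.X s ω)) :=
    (Measurable.lintegral_kernel hφ).comp (M.measurable_eval _)
  have hmeas : (((M.law x).withDensity fun ω => φ (M.X (s + t) ω)).trim (M.past_le s)) =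
      ((M.law x).withDensity
        fun ω => ∫⁻ y, φ y ∂(M.transition t (M.X s ω))).trim (M.past_le s) := by
    refine @Measure.ext _ (M.past s) _ _ fun A hA => ?_
    rw [trim_measurableSet_eq _ hA, trim_measurableSet_eq _ hA,
      withDensity_apply _ (M.past_le s _ hA), withDensity_apply _ (M.past_le s _ hA),
      M.markov_restrict x s t hA hφ]
  have hg' : Measurable g := hg.mono (M.past_le s) le_rfl
  calc ∫⁻ ω, g ω * φ (M.X (s + t) ω) ∂(M.law x)
      = ∫⁻ ω, g ω ∂((M.law x).withDensity fun ω => φ (M.X (s + t) ω)) := by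
        rw [lintegral_withDensity_eq_lintegral_mul _ hφ1 hg']
        simp [mul_comm]
    _ = ∫⁻ ω, g ω ∂((M.law x).withDensity
        fun ω => ∫⁻ y, φ y ∂(M.transition t (M.X s ω))) := by
        rw [← lintegral_trim (M.past_le s) hg, hmeas, lintegral_trim (M.past_le s) hg]
    _ = _ := by
        rw [lintegral_withDensity_eq_lintegral_mul _ hφ2 hg']
        simp [mul_comm]

/-- The iterated integrals in the Dyson expansion of the Feynman-Kac semigroup. -/
noncomputable def dyson (W : E → ℝ) : ℕ → ℝ → E → ℝ≥0∞
  | 0 => fun _ _ => 1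
  | n + 1 => fun t x => ∫⁻ r in Ioc 0 t, ∫⁻ ω,
      ENNReal.ofReal (W (M.X r.toNNReal ω)) * dyson W n (t - r) (M.X r.toNNReal ω) ∂(M.law x)

variable {M} {W : E → ℝ} {B : ℝ}

theorem intervalIntegrable_path (hW : Measurable W) (hB : ∀ x, |W x| ≤ B) (ω : Ω) (a b : ℝ) :
    IntervalIntegrable (fun s : ℝ => W (M.X s.toNNReal ω)) volume a b := by
  have h1 : Measurable fun s : ℝ => W (M.X s.toNNReal ω) :=
    (M.measurable_path hW).comp measurable_prodMk_right
  exact (intervalIntegrable_const (c := B)).mono_fun h1.aestronglyMeasurable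
    (Eventually.of_forall fun s => by
      simpa using (hB _).trans (le_abs_self B))

theorem measurable_pathIntegral (hW : Measurable W) (a b : ℝ) :
    Measurable (M.pathIntegral W a b) := by
  have h : StronglyMeasurable fun p : Ω × ℝ => W (M.X p.2.toNNReal p.1) :=
    ((M.measurable_path hW).comp measurable_swap).stronglyMeasurable
  unfold pathIntegral
  simp only [intervalIntegral]
  exact (h.integral_prod_right' (ν := volume.restrict (Ioc a b))).measurable.sub
    (h.integral_prod_right' (ν := volume.restrict (Ioc b a))).measurable

theorem measurable_pathIntegral_uncurry (hW : Measurable W) (hB : ∀ x, |W x| ≤ B) (b : ℝ) :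
    Measurable fun p : ℝ × Ω => M.pathIntegral W p.1 b p.2 := by
  refine measurable_uncurry_of_continuous_of_measurable (u := fun a ω => M.pathIntegral W a b ω)
    (fun ω => ?_) (fun a => measurable_pathIntegral hW a b)
  have := intervalIntegral.continuous_primitive
    (fun a' b' => intervalIntegrable_path (M := M) hW hB ω a' b') b
  have h2 : (fun a => M.pathIntegral W a b ω) =
      fun a => -∫ s in b..a, W (M.X s.toNNReal ω) := by
    ext a; exact intervalIntegral.integral_symm _ _
  rw [h2]; exact this.neg

theorem abs_pathIntegral_le (hB : ∀ x, |W x| ≤ B) (a b : ℝ) (ω : Ω) :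
    |M.pathIntegral W a b ω| ≤ B * |b - a| := by
  rw [← Real.norm_eq_abs]
  exact intervalIntegral.norm_integral_le_of_norm_le_const fun s _ => hB _

theorem pathIntegral_nonneg (h0 : ∀ x, 0 ≤ W x) {a b : ℝ} (hab : a ≤ b) (ω : Ω) :
    0 ≤ M.pathIntegral W a b ω :=
  intervalIntegral.integral_nonneg hab fun _ _ => h0 _

theorem measurable_dyson_integrand (hW : Measurable W) {k : ℝ → E → ℝ≥0∞}
    (hk : Measurable fun p : ℝ × E => k p.1 p.2) :
    Measurable fun q : (ℝ × E) × ℝ =>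
      ∫⁻ ω, ENNReal.ofReal (W (M.X q.2.toNNReal ω)) *
        k (q.1.1 - q.2) (M.X q.2.toNNReal ω) ∂(M.law q.1.2) := by
  have h0 : Measurable fun q : ((ℝ × E) × ℝ) × Ω => M.X q.1.2.toNNReal q.2 := by
    have : Measurable fun q : ((ℝ × E) × ℝ) × Ω => ((q.1.2.toNNReal, q.2) : ℝ≥0 × Ω) := by
      fun_prop
    exact M.measurable_X.comp this
  have h1 : Measurable fun q : ((ℝ × E) × ℝ) × Ω =>
      ENNReal.ofReal (W (M.X q.1.2.toNNReal q.2)) *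
        k (q.1.1.1 - q.1.2) (M.X q.1.2.toNNReal q.2) := by
    have h : Measurable fun q : ((ℝ × E) × ℝ) × Ω => q.1.1.1 - q.1.2 := by fun_prop
    exact (hW.comp h0).ennreal_ofReal.mul (hk.comp (h.prodMk h0))
  have := Measurable.lintegral_kernel_prod_right'
    (κ := M.law.comap (fun q : (ℝ × E) × ℝ => q.1.2) (by fun_prop)) h1
  simpa only [Kernel.comap_apply] using this

theorem measurable_dyson (hW : Measurable W) (n : ℕ) :
    Measurable fun p : ℝ × E => M.dyson W n p.1 p.2 := by
  induction n with
  | zero => exact measurable_const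
  | succ n ih =>
    have hS : MeasurableSet {q : (ℝ × E) × ℝ | q.2 ∈ Ioc 0 q.1.1} :=
      (measurableSet_lt measurable_const measurable_snd).inter
        (measurableSet_le measurable_snd (measurable_fst.comp measurable_fst))
    have h4 := Measurable.lintegral_prod_right' (ν := (volume : Measure ℝ))
      ((measurable_dyson_integrand (M := M) hW ih).indicator hS)
    convert h4 using 2 with p
    simp only [dyson]
    rw [← lintegral_indicator measurableSet_Ioc]
    rfl

/-- Splits off the earliest time variable of the iterated integral, which is the recursion defining
`dyson`. -/
theorem ofReal_pathIntegral_pow (hW : Measurable W) (hB : ∀ x, |W x| ≤ B) (h0 : ∀ x, 0 ≤ W x)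
    (n : ℕ) (s : ℝ≥0) {t : ℝ} (ht : 0 ≤ t) (ω : Ω) :
    ENNReal.ofReal (M.pathIntegral W s (s + t) ω ^ (n + 1) / (n + 1).factorial) =
      ∫⁻ r in Ioc 0 t, ENNReal.ofReal (W (M.X (s + r).toNNReal ω)) *
        ENNReal.ofReal (M.pathIntegral W (s + r) (s + t) ω ^ n / n.factorial) := by
  have hInt : IntervalIntegrable (fun r => W (M.X (s + r).toNNReal ω) *
      (M.pathIntegral W (s + r) (s + t) ω ^ n / n.factorial)) volume 0 t := by
    have h1 : Measurable fun r : ℝ => W (M.X (s + r).toNNReal ω) :=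
      ((M.measurable_path hW).comp measurable_prodMk_right).comp (measurable_const_add (s : ℝ))
    have h2 : Measurable fun r : ℝ => M.pathIntegral W (s + r) (s + t) ω :=
      ((measurable_pathIntegral_uncurry hW hB _).comp measurable_prodMk_right).comp
        (measurable_const_add (s : ℝ))
    refine (intervalIntegrable_const (c := B * ((B * t) ^ n / n.factorial))).mono_fun
      (h1.mul ((h2.pow_const n).div_const _)).aestronglyMeasurable ?_
    refine (ae_restrict_iff' measurableSet_uIoc).mpr (Eventually.of_forall fun r hr => ?_)
    rw [uIoc_of_le ht] at hr
    have hB0 : 0 ≤ B := (abs_nonneg _).trans (hB (M.X 0 ω))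
    have h3 : |M.pathIntegral W (s + r) (s + t) ω| ≤ B * t := by
      refine (abs_pathIntegral_le hB _ _ ω).trans ?_
      rw [abs_of_nonneg (by linarith [hr.2])]
      exact mul_le_mul_of_nonneg_left (by linarith [hr.1]) hB0
    beta_reduce
    rw [Real.norm_eq_abs, Real.norm_eq_abs, abs_mul, abs_div, abs_pow,
      abs_of_nonneg (a := (n.factorial : ℝ)) (by positivity)]
    refine le_trans ?_ (le_abs_self _)
    gcongr
    exact hB _
  have hkey := integral_mul_integral_pow
    (intervalIntegrable_path (M := M) hW hB ω s (s + t)) n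
  have hshift := intervalIntegral.integral_comp_add_left (a := 0) (b := t)
    (fun r => W (M.X r.toNNReal ω) * (M.pathIntegral W r (s + t) ω ^ n / n.factorial)) (s : ℝ)
  rw [add_zero] at hshift
  unfold pathIntegral at *
  rw [← hkey, ← hshift, intervalIntegral.integral_of_le ht,
    ofReal_integral_eq_lintegral_ofReal]
  · exact lintegral_congr fun r => ENNReal.ofReal_mul (h0 _)
  · exact (intervalIntegrable_iff_integrableOn_Ioc_of_le ht).mp hInt
  · refine (ae_restrict_iff' measurableSet_Ioc).mpr (Eventually.of_forall fun r hr => ?_)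
    refine mul_nonneg (h0 _) (div_nonneg (pow_nonneg ?_ _) (by positivity))
    exact intervalIntegral.integral_nonneg (by linarith [hr.2]) fun _ _ => h0 _

/-- The weight `g` makes the induction close: after the earliest variable is split off at time `s +
r`, the factor `W(X_{s+r})` joins `g`, the product is measurable in the past of `s + r`, and the
induction hypothesis applies from there. The one-time Markov property then brings everything back to
time `s`. Nonnegativity of `W` permits the exchanges of integrals in `ℝ≥0∞`. -/
theorem lintegral_mul_pathIntegral_pow (hW : Measurable W) (hB : ∀ x, |W x| ≤ B)
    (h0 : ∀ x, 0 ≤ W x) (n : ℕ) (x : E) : ∀ (s : ℝ≥0) {t : ℝ}, 0 ≤ t → ∀ {g : Ω → ℝ≥0∞},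
    Measurable[M.past s] g →
    ∫⁻ ω, g ω * ENNReal.ofReal (M.pathIntegral W s (s + t) ω ^ n / n.factorial) ∂(M.law x) =
      ∫⁻ ω, g ω * M.dyson W n t (M.X s ω) ∂(M.law x) := by
  induction n with
  | zero => intro s t ht g hg; simp [dyson]
  | succ n ih =>
    intro s t ht g hg
    have hg' : Measurable g := hg.mono (M.past_le s) le_rfl
    have hm1 : Measurable fun p : Ω × ℝ => ENNReal.ofReal (W (M.X (s + p.2).toNNReal p.1)) *
        ENNReal.ofReal (M.pathIntegral W (s + p.2) (s + t) p.1 ^ n / n.factorial) := by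
      have ha : Measurable fun p : Ω × ℝ => ((s + p.2, p.1) : ℝ × Ω) := by fun_prop
      exact ((M.measurable_path hW).comp ha).ennreal_ofReal.mul
        ((((measurable_pathIntegral_uncurry hW hB _).comp ha).pow_const n).div_const
          _).ennreal_ofReal
    have hm2 : Measurable fun p : Ω × ℝ => ∫⁻ ω', ENNReal.ofReal (W (M.X p.2.toNNReal ω')) *
        M.dyson W n (t - p.2) (M.X p.2.toNNReal ω') ∂(M.law (M.X s p.1)) := by
      have ha : Measurable fun p : Ω × ℝ => (((t, M.X s p.1), p.2) : (ℝ × E) × ℝ) :=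
        (measurable_const.prodMk ((M.measurable_eval s).comp measurable_fst)).prodMk
          measurable_snd
      exact (measurable_dyson_integrand hW (measurable_dyson hW n)).comp ha
    calc _ = ∫⁻ ω, (∫⁻ r in Ioc 0 t, g ω * (ENNReal.ofReal (W (M.X (s + r).toNNReal ω)) *
          ENNReal.ofReal (M.pathIntegral W (s + r) (s + t) ω ^ n / n.factorial))) ∂(M.law x) := by
          refine lintegral_congr fun ω => ?_
          rw [ofReal_pathIntegral_pow hW hB h0 n s ht ω]
          exact (lintegral_const_mul _ (hm1.comp measurable_prodMk_left)).symm
      _ = ∫⁻ r in Ioc 0 t, ∫⁻ ω, g ω * (ENNReal.ofReal (W (M.X (s + r).toNNReal ω)) *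
          ENNReal.ofReal (M.pathIntegral W (s + r) (s + t) ω ^ n / n.factorial)) ∂(M.law x) :=
          lintegral_lintegral_swap ((hg'.comp measurable_fst).mul hm1).aemeasurable
      _ = ∫⁻ r in Ioc 0 t, ∫⁻ ω, g ω * (∫⁻ ω', ENNReal.ofReal (W (M.X r.toNNReal ω')) *
          M.dyson W n (t - r) (M.X r.toNNReal ω') ∂(M.law (M.X s ω))) ∂(M.law x) := by
          refine setLIntegral_congr_fun measurableSet_Ioc fun r hr => ?_
          have hr0 : (r.toNNReal : ℝ) = r := Real.coe_toNNReal r hr.1.le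
          have hsr : (s + r : ℝ).toNNReal = s + r.toNNReal := by
            rw [Real.toNNReal_add s.coe_nonneg hr.1.le, Real.toNNReal_coe]
          -- The enlarged weight for the induction hypothesis, restarted at `s + r` with remaining
          -- time `t - r`.
          have hg2 : Measurable[M.past (s + r.toNNReal)]
              fun ω => g ω * ENNReal.ofReal (W (M.X (s + r.toNNReal) ω)) :=
            (hg.mono (M.past_mono le_self_add) le_rfl).mul
              ((hW.comp (M.measurable_eval_past _)).ennreal_ofReal)
          have hih := ih (s + r.toNNReal) (t := t - r) (by linarith [hr.2]) hg2
          have e1 : ((s + r.toNNReal : ℝ≥0) : ℝ) = s + r := by rw [NNReal.coe_add, hr0]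
          have e2 : (s + r + (t - r) : ℝ) = s + t := by ring
          rw [e1, e2] at hih
          have hφ : Measurable fun y => ENNReal.ofReal (W y) * M.dyson W n (t - r) y :=
            hW.ennreal_ofReal.mul ((measurable_dyson hW n).comp measurable_prodMk_left)
          have hmk := M.markov_lintegral x s r.toNNReal hg hφ
          simp only [hsr, ← mul_assoc] at hih hmk ⊢
          rw [hih, hmk]
          refine lintegral_congr fun ω => ?_
          rw [M.lintegral_transition _ _ hφ]
      _ = ∫⁻ ω, (∫⁻ r in Ioc 0 t, g ω * (∫⁻ ω', ENNReal.ofReal (W (M.X r.toNNReal ω')) *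
          M.dyson W n (t - r) (M.X r.toNNReal ω') ∂(M.law (M.X s ω)))) ∂(M.law x) :=
          (lintegral_lintegral_swap ((hg'.comp measurable_fst).mul hm2).aemeasurable).symm
      _ = _ := by
          exact lintegral_congr fun ω => lintegral_const_mul _ (hm2.comp measurable_prodMk_left)

theorem lintegral_exp_pathIntegral (hW : Measurable W) (hB : ∀ x, |W x| ≤ B)
    (h0 : ∀ x, 0 ≤ W x) (x : E) (s : ℝ≥0) {t : ℝ} (ht : 0 ≤ t) :
    ∫⁻ ω, ENNReal.ofReal (Real.exp (M.pathIntegral W s (s + t) ω)) ∂(M.law x) =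
      ∫⁻ ω, ∑' n, M.dyson W n t (M.X s ω) ∂(M.law x) := by
  have h : ∀ ω, ENNReal.ofReal (Real.exp (M.pathIntegral W s (s + t) ω)) =
      ∑' n : ℕ, ENNReal.ofReal (M.pathIntegral W s (s + t) ω ^ n / n.factorial) := fun ω => by
    have hn : 0 ≤ M.pathIntegral W s (s + t) ω := pathIntegral_nonneg h0 (by linarith) ω
    rw [Real.exp_eq_exp_ℝ, NormedSpace.exp_eq_tsum_div,
      ENNReal.ofReal_tsum_of_nonneg (fun n => by positivity)
        (NormedSpace.expSeries_div_summable _)]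
  simp_rw [h]
  rw [lintegral_tsum fun n =>
      (((measurable_pathIntegral hW _ _).pow_const n).div_const _).ennreal_ofReal.aemeasurable,
    lintegral_tsum (f := fun n ω => M.dyson W n t (M.X s ω)) fun n =>
      ((measurable_dyson hW n).comp
        (measurable_const.prodMk (M.measurable_eval s))).aemeasurable]
  refine tsum_congr fun n => ?_
  simpa using lintegral_mul_pathIntegral_pow (M := M) hW hB h0 n x s ht
    (g := fun _ => 1) measurable_const

/-- The Feynman-Kac semigroup applied to the constant function `1`. -/
noncomputable def feynmanKac (M : MarkovProcess E Ω) (W : E → ℝ) (t : ℝ) (x : E) : ℝ :=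
  ∫ ω, Real.exp (M.pathIntegral W 0 t ω) ∂(M.law x)

theorem abs_exp_pathIntegral_le (hB : ∀ x, |W x| ≤ B) {a b : ℝ} (hab : a ≤ b) (ω : Ω) :
    |Real.exp (M.pathIntegral W a b ω)| ≤ Real.exp (B * (b - a)) := by
  rw [abs_of_pos (Real.exp_pos _), Real.exp_le_exp]
  have := (le_abs_self _).trans (abs_pathIntegral_le hB a b ω (M := M))
  rwa [abs_of_nonneg (sub_nonneg.mpr hab)] at this

theorem integrable_exp_pathIntegral (hW : Measurable W) (hB : ∀ x, |W x| ≤ B) {a b : ℝ}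
    (hab : a ≤ b) (P : Measure Ω) [IsFiniteMeasure P] :
    Integrable (fun ω => Real.exp (M.pathIntegral W a b ω)) P :=
  Integrable.of_bound (measurable_pathIntegral hW a b).exp.aestronglyMeasurable _
    (Eventually.of_forall fun ω => abs_exp_pathIntegral_le hB hab ω)

theorem feynmanKac_nonneg (t : ℝ) (x : E) : 0 ≤ M.feynmanKac W t x :=
  integral_nonneg fun _ => (Real.exp_pos _).le

theorem ofReal_feynmanKac (hW : Measurable W) (hB : ∀ x, |W x| ≤ B) {t : ℝ} (ht : 0 ≤ t) (x : E) :
    ENNReal.ofReal (M.feynmanKac W t x) =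
      ∫⁻ ω, ENNReal.ofReal (Real.exp (M.pathIntegral W 0 t ω)) ∂(M.law x) :=
  ofReal_integral_eq_lintegral_ofReal (integrable_exp_pathIntegral hW hB ht _)
    (Eventually.of_forall fun _ => (Real.exp_pos _).le)

theorem measurable_feynmanKac (hW : Measurable W) (t : ℝ) : Measurable (M.feynmanKac W t) :=
  (StronglyMeasurable.integral_kernel
    (measurable_pathIntegral (M := M) hW 0 t).exp.stronglyMeasurable).measurable

/-- The Dyson expansion at time `0`, together with `X_0 = y`, identifies `feynmanKac` with the Dyson
series; the same expansion at time `s` is then the Markov property for this path functional. -/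
theorem semigroup_feynmanKac (hW : Measurable W) (hB : ∀ x, |W x| ≤ B)
    (h0 : ∀ x, 0 ≤ W x) (x : E) (s : ℝ≥0) {t : ℝ} (ht : 0 ≤ t) :
    M.semigroup s (M.feynmanKac W t) x =
      ∫ ω, Real.exp (M.pathIntegral W s (s + t) ω) ∂(M.law x) := by
  have hu : ∀ y, ENNReal.ofReal (M.feynmanKac W t y) = ∑' n, M.dyson W n t y := fun y => by
    have h1 := lintegral_exp_pathIntegral (M := M) hW hB h0 y 0 ht
    simp only [NNReal.coe_zero, zero_add] at h1
    rw [ofReal_feynmanKac hW hB ht, h1,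
      lintegral_congr_ae (g := fun _ => ∑' n, M.dyson W n t y)
        ((M.start y).mono fun ω hω => by simp only [hω])]
    simp
  rw [semigroup, integral_eq_lintegral_of_nonneg_ae
      (Eventually.of_forall fun y => feynmanKac_nonneg t y)
      (measurable_feynmanKac hW t).aestronglyMeasurable,
    integral_eq_lintegral_of_nonneg_ae (Eventually.of_forall fun _ => (Real.exp_pos _).le)
      (measurable_pathIntegral hW _ _).exp.aestronglyMeasurable,
    lintegral_exp_pathIntegral hW hB h0 x s ht,
    M.lintegral_transition _ _ (measurable_feynmanKac hW t).ennreal_ofReal]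
  simp_rw [hu]

end MarkovProcess

/-! ### Mean continuity in time under the stationary law. -/

theorem tendsto_lintegral_enorm_translate_sub {w : ℝ → ℝ} (hw : Integrable w) :
    Tendsto (fun h : ℝ => ∫⁻ s, ‖w (s + h) - w s‖ₑ) (𝓝 0) (𝓝 0) := by
  have hw1 : MemLp w 1 := memLp_one_iff_integrable.mpr hw
  have hmp : ∀ h : ℝ, MeasurePreserving (fun s : ℝ => s + h) :=
    fun h => measurePreserving_add_right volume h
  let g : ℝ → C(ℝ, ℝ) := fun h => ⟨fun s => s + h, by fun_prop⟩
  have hgmp : ∀ h : ℝ, MeasurePreserving (g h) volume volume := hmp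
  have hg : Continuous g := ContinuousMap.continuous_of_continuous_uncurry _ (by
    simp only [Function.uncurry_def]
    change Continuous fun p : ℝ × ℝ => p.2 + p.1
    fun_prop)
  have hcont := (continuous_const (y := hw1.toLp w)).compMeasurePreservingLp hg
    (μ := volume) hgmp ENNReal.one_ne_top
  have h0 := (hcont.tendsto 0).edist tendsto_const_nhds
    (b := Lp.compMeasurePreserving (g 0) (hgmp 0) (hw1.toLp w))
  rw [edist_self] at h0
  refine h0.congr fun h => ?_
  rw [Lp.toLp_compMeasurePreserving hw1 (hgmp h), Lp.toLp_compMeasurePreserving hw1 (hgmp 0),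
    Lp.edist_toLp_toLp, eLpNorm_one_eq_lintegral_enorm]
  simp [g]

theorem tendsto_setLIntegral_enorm_translate_sub {w : ℝ → ℝ} {B : ℝ} (hw : Measurable w)
    (hB : ∀ s, |w s| ≤ B) :
    Tendsto (fun h : ℝ => ∫⁻ s in Ioc 0 1, ‖w (s + h) - w s‖ₑ) (𝓝[>] 0) (𝓝 0) := by
  -- Cutting off at `2` makes `w` integrable without affecting the window `(0, 1]` or its translates
  -- by `h < 1`.
  have hInt : Integrable ((Ioc (0 : ℝ) 2).indicator w) := by
    rw [integrable_indicator_iff measurableSet_Ioc]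
    exact Integrable.of_bound hw.aestronglyMeasurable B (Eventually.of_forall hB)
  refine tendsto_of_tendsto_of_tendsto_of_le_of_le' tendsto_const_nhds
    ((tendsto_lintegral_enorm_translate_sub hInt).mono_left nhdsWithin_le_nhds)
    (Eventually.of_forall fun _ => zero_le) ?_
  filter_upwards [Ioo_mem_nhdsGT (zero_lt_one' ℝ)] with h hh
  refine le_trans (le_of_eq ?_) (setLIntegral_le_lintegral (Ioc 0 1) _)
  refine setLIntegral_congr_fun measurableSet_Ioc fun s hs => ?_
  have h1 : s + h ∈ Ioc (0 : ℝ) 2 := ⟨by linarith [hs.1, hh.1], by linarith [hs.2, hh.2]⟩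
  have h2 : s ∈ Ioc (0 : ℝ) 2 := ⟨hs.1, by linarith [hs.2]⟩
  simp only [indicator_of_mem h1, indicator_of_mem h2]

namespace MarkovProcess

variable {E Ω : Type*} [MeasurableSpace E] [MeasurableSpace Ω] {M : MarkovProcess E Ω}
  {μ : Measure E} {W : E → ℝ} {B : ℝ}

theorem lintegral_initLaw (ν : Measure E) {Y : Ω → ℝ≥0∞} (hY : Measurable Y) :
    ∫⁻ ω, Y ω ∂(M.initLaw ν) = ∫⁻ x, ∫⁻ ω, Y ω ∂(M.law x) ∂ν :=
  Measure.lintegral_bind M.law.aemeasurable hY.aemeasurable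

instance (ν : Measure E) [IsProbabilityMeasure ν] : IsProbabilityMeasure (M.initLaw ν) :=
  inferInstanceAs (IsProbabilityMeasure (ν.bind M.law))

theorem IsInvariant.map_eval (hμ : M.IsInvariant μ) (t : ℝ≥0) :
    (M.initLaw μ).map (M.X t) = μ := by
  ext A hA
  rw [Measure.map_apply (M.measurable_eval t) hA, initLaw,
    Measure.bind_apply (M.measurable_eval t hA) M.law.aemeasurable]
  conv_rhs => rw [← hμ t, Measure.bind_apply hA (Kernel.aemeasurable _)]
  refine lintegral_congr fun x => ?_
  rw [transition, Kernel.map_apply' _ (M.measurable_eval t) _ hA]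

theorem IsInvariant.initLaw_inter (hμ : M.IsInvariant μ) (s h : ℝ≥0) {A C : Set E}
    (hA : MeasurableSet A) (hC : MeasurableSet C) :
    M.initLaw μ (M.X s ⁻¹' A ∩ M.X (s + h) ⁻¹' C) =
      ∫⁻ x in A, M.law x (M.X h ⁻¹' C) ∂μ := by
  have hmk : Measurable fun x => M.law x (M.X h ⁻¹' C) :=
    Kernel.measurable_coe _ (M.measurable_eval h hC)
  have hAs : MeasurableSet (M.X s ⁻¹' A) := M.measurable_eval s hA
  rw [initLaw, Measure.bind_apply
    ((M.measurable_eval s hA).inter (M.measurable_eval _ hC)) M.law.aemeasurable]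
  have h1 : ∀ x, M.law x (M.X s ⁻¹' A ∩ M.X (s + h) ⁻¹' C) =
      ∫⁻ ω, (M.X s ⁻¹' A).indicator (fun ω => M.law (M.X s ω) (M.X h ⁻¹' C)) ω ∂(M.law x) :=
    fun x => by
      rw [lintegral_indicator hAs]
      exact M.markov x s h _ (M.measurable_eval_past s hA) C hC
  simp_rw [h1]
  rw [← lintegral_initLaw (M := M) μ
      (Y := (M.X s ⁻¹' A).indicator fun ω => M.law (M.X s ω) (M.X h ⁻¹' C))
      ((hmk.comp (M.measurable_eval s)).indicator hAs),
    ← lintegral_indicator hA]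
  conv_rhs => rw [← hμ.map_eval s, lintegral_map (hmk.indicator hA) (M.measurable_eval s)]
  rfl

theorem IsInvariant.map_pair [IsProbabilityMeasure μ] (hμ : M.IsInvariant μ) (s h : ℝ≥0) :
    (M.initLaw μ).map (fun ω => (M.X s ω, M.X (s + h) ω)) =
      (M.initLaw μ).map (fun ω => (M.X 0 ω, M.X h ω)) := by
  have hm : ∀ r : ℝ≥0, Measurable fun ω => (M.X s ω, M.X r ω) := fun r =>
    (M.measurable_eval s).prodMk (M.measurable_eval r)
  have hm0 : Measurable fun ω => (M.X 0 ω, M.X h ω) :=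
    (M.measurable_eval 0).prodMk (M.measurable_eval h)
  have : IsProbabilityMeasure ((M.initLaw μ).map (fun ω => (M.X s ω, M.X (s + h) ω))) :=
    Measure.isProbabilityMeasure_map (hm _).aemeasurable
  refine Measure.ext_prod fun {A C} hA hC => ?_
  rw [Measure.map_apply (hm _) (hA.prod hC), Measure.map_apply hm0 (hA.prod hC),
    mk_preimage_prod, mk_preimage_prod, hμ.initLaw_inter s h hA hC]
  simpa using (hμ.initLaw_inter 0 h hA hC).symm

theorem IsInvariant.lintegral_increment [IsProbabilityMeasure μ] (hμ : M.IsInvariant μ)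
    (hW : Measurable W) {s h : ℝ} (hs : 0 ≤ s) (hh : 0 ≤ h) :
    ∫⁻ ω, ‖W (M.X (s + h).toNNReal ω) - W (M.X s.toNNReal ω)‖ₑ ∂(M.initLaw μ) =
      ∫⁻ ω, ‖W (M.X h.toNNReal ω) - W (M.X 0 ω)‖ₑ ∂(M.initLaw μ) := by
  have hφ : Measurable fun p : E × E => ‖W p.2 - W p.1‖ₑ :=
    ((hW.comp measurable_snd).sub (hW.comp measurable_fst)).enorm
  have hm : ∀ r r' : ℝ≥0, Measurable fun ω => (M.X r ω, M.X r' ω) := fun r r' =>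
    (M.measurable_eval r).prodMk (M.measurable_eval r')
  rw [Real.toNNReal_add hs hh]
  have h1 := lintegral_map (μ := M.initLaw μ) hφ (hm s.toNNReal (s.toNNReal + h.toNNReal))
  rw [hμ.map_pair, lintegral_map hφ (hm _ _)] at h1
  exact h1.symm

/-- By stationarity the mean increment over `[s, s + h]` does not depend on `s`, so it equals its
average over `s ∈ (0, 1]`. After Fubini, each path contributes the `L¹` distance to its translate,
which tends to zero by mere measurability and boundedness; dominated convergence concludes. -/
theorem IsInvariant.tendsto_lintegral_increment [IsProbabilityMeasure μ] (hμ : M.IsInvariant μ)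
    (hW : Measurable W) (hB : ∀ x, |W x| ≤ B) :
    Tendsto (fun h : ℝ => ∫⁻ ω, ‖W (M.X h.toNNReal ω) - W (M.X 0 ω)‖ₑ ∂(M.initLaw μ))
      (𝓝[>] 0) (𝓝 0) := by
  have hpath := M.measurable_path hW
  have hm : ∀ h : ℝ, Measurable fun p : ℝ × Ω =>
      ‖W (M.X (p.1 + h).toNNReal p.2) - W (M.X p.1.toNNReal p.2)‖ₑ := fun h => by
    have ha : Measurable fun p : ℝ × Ω => ((p.1 + h, p.2) : ℝ × Ω) := by fun_prop
    exact ((hpath.comp ha).sub hpath).enorm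
  have hbd : ∀ h ω, ∫⁻ s in Ioc (0 : ℝ) 1,
      ‖W (M.X (s + h).toNNReal ω) - W (M.X s.toNNReal ω)‖ₑ ≤ ENNReal.ofReal (2 * B) := by
    intro h ω
    refine (setLIntegral_mono (g := fun _ => ENNReal.ofReal (2 * B)) measurable_const
      fun s _ => ?_).trans (by simp)
    rw [← ofReal_norm]
    refine ENNReal.ofReal_le_ofReal ((norm_sub_le _ _).trans ?_)
    rw [two_mul]
    exact add_le_add (hB _) (hB _)
  have hdom := tendsto_lintegral_filter_of_dominated_convergence (μ := M.initLaw μ)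
    (F := fun (h : ℝ) ω => ∫⁻ s in Ioc (0 : ℝ) 1,
      ‖W (M.X (s + h).toNNReal ω) - W (M.X s.toNNReal ω)‖ₑ)
    (f := fun _ => 0) (l := 𝓝[>] 0) (fun _ => ENNReal.ofReal (2 * B))
    (Eventually.of_forall fun h => (hm h).lintegral_prod_left')
    (Eventually.of_forall fun h => Eventually.of_forall (hbd h))
    (by rw [lintegral_const, measure_univ, mul_one]; exact ENNReal.ofReal_ne_top)
    (Eventually.of_forall fun ω => tendsto_setLIntegral_enorm_translate_sub
      (hpath.comp measurable_prodMk_right) (fun s => hB _))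
  rw [lintegral_zero] at hdom
  refine hdom.congr' ?_
  filter_upwards [self_mem_nhdsWithin] with h hh
  rw [← lintegral_lintegral_swap (hm h).aemeasurable,
    setLIntegral_congr_fun (g := fun _ => ∫⁻ ω, ‖W (M.X h.toNNReal ω) - W (M.X 0 ω)‖ₑ
      ∂(M.initLaw μ)) measurableSet_Ioc
      fun s hs => hμ.lintegral_increment hW hs.1.le (le_of_lt hh)]
  simp

theorem IsInvariant.tendsto_lintegral_average [IsProbabilityMeasure μ] (hμ : M.IsInvariant μ)
    (hW : Measurable W) (hB : ∀ x, |W x| ≤ B) {t : ℝ} (ht : 0 ≤ t) :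
    Tendsto (fun h : ℝ => ∫⁻ ω, ‖M.pathIntegral W t (t + h) ω / h - W (M.X t.toNNReal ω)‖ₑ
      ∂(M.initLaw μ)) (𝓝[>] 0) (𝓝 0) := by
  have hpath := M.measurable_path hW
  rw [ENNReal.tendsto_nhds_zero]
  intro ε hε
  -- A bound uniform over all increments of length at most `δ`, hence also valid for their average.
  obtain ⟨δ, hδ, hδε⟩ := mem_nhdsGT_iff_exists_Ioc_subset.mp
    (ENNReal.tendsto_nhds_zero.mp (hμ.tendsto_lintegral_increment hW hB) ε hε)
  filter_upwards [Ioc_mem_nhdsGT hδ] with h hh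
  have hm : Measurable fun p : Ω × ℝ =>
      ‖W (M.X (t + p.2).toNNReal p.1) - W (M.X t.toNNReal p.1)‖ₑ := by
    have ha : Measurable fun p : Ω × ℝ => ((t + p.2, p.1) : ℝ × Ω) := by fun_prop
    have hb : Measurable fun p : Ω × ℝ => ((t, p.1) : ℝ × Ω) := by fun_prop
    exact ((hpath.comp ha).sub (hpath.comp hb)).enorm
  have hpt : ∀ ω, ‖M.pathIntegral W t (t + h) ω / h - W (M.X t.toNNReal ω)‖ₑ ≤
      ENNReal.ofReal h⁻¹ * ∫⁻ r in Ioc 0 h,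
        ‖W (M.X (t + r).toNNReal ω) - W (M.X t.toNNReal ω)‖ₑ := fun ω => by
    have hi := intervalIntegrable_path (M := M) hW hB ω
    have h1 : M.pathIntegral W t (t + h) ω / h - W (M.X t.toNNReal ω) =
        h⁻¹ * ∫ r in Ioc 0 h, (W (M.X (t + r).toNNReal ω) - W (M.X t.toNNReal ω)) := by
      rw [← intervalIntegral.integral_of_le hh.1.le, intervalIntegral.integral_sub
        (by simpa using (hi (t + 0) (t + h)).comp_add_left t) intervalIntegrable_const,
        intervalIntegral.integral_comp_add_left (fun r => W (M.X r.toNNReal ω)) t,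
        intervalIntegral.integral_const, add_zero, pathIntegral]
      have := hh.1.ne'
      simp only [sub_zero, smul_eq_mul]
      field_simp
    rw [h1, enorm_mul, Real.enorm_of_nonneg (inv_nonneg.mpr hh.1.le)]
    gcongr
    exact enorm_integral_le_lintegral_enorm _
  calc _ ≤ ∫⁻ ω, ENNReal.ofReal h⁻¹ * (∫⁻ r in Ioc 0 h,
        ‖W (M.X (t + r).toNNReal ω) - W (M.X t.toNNReal ω)‖ₑ) ∂(M.initLaw μ) :=
        lintegral_mono hpt
    _ = ENNReal.ofReal h⁻¹ * ∫⁻ r in Ioc 0 h, (∫⁻ ω,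
        ‖W (M.X (t + r).toNNReal ω) - W (M.X t.toNNReal ω)‖ₑ ∂(M.initLaw μ)) := by
        rw [lintegral_const_mul _ hm.lintegral_prod_right',
          lintegral_lintegral_swap hm.aemeasurable]
    _ ≤ ENNReal.ofReal h⁻¹ * ∫⁻ r in Ioc 0 h, ε := by
        gcongr ENNReal.ofReal h⁻¹ * ?_
        refine setLIntegral_mono measurable_const fun r hr => ?_
        rw [hμ.lintegral_increment hW ht hr.1.le]
        exact hδε ⟨hr.1, hr.2.trans hh.2⟩
    _ = ε := by
        rw [setLIntegral_const, Real.volume_Ioc, sub_zero, mul_comm ε, ← mul_assoc,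
          ← ENNReal.ofReal_mul (inv_nonneg.mpr hh.1.le), inv_mul_cancel₀ hh.1.ne',
          ENNReal.ofReal_one, one_mul]

end MarkovProcess

theorem abs_exp_sub_one_div_sub_le {z h c : ℝ} (hz : |z| ≤ 1) (hh : 0 < h) :
    |(Real.exp z - 1) / h - c| ≤ z ^ 2 / h + |z / h - c| := by
  have h1 : (Real.exp z - 1) / h - c = (Real.exp z - 1 - z) / h + (z / h - c) := by ring
  rw [h1]
  refine (abs_add_le _ _).trans (add_le_add ?_ le_rfl)
  rw [abs_div, abs_of_pos hh]
  gcongr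
  exact Real.abs_exp_sub_one_sub_id_le hz

/-- Linearisation of the exponential in mean: as `|Z h| ≤ C h`, the quadratic remainder `Z² / h` is
at most `C² h`, and the linear part converges by assumption. -/
theorem tendsto_lintegral_mul_exp_sub_one_div_sub {Ω : Type*} [MeasurableSpace Ω] {P : Measure Ω}
    [IsProbabilityMeasure P] {Z : ℝ → Ω → ℝ} {U c : Ω → ℝ} {K C : ℝ}
    (hZ : ∀ h, Measurable (Z h)) (hc : Measurable c) (hU : ∀ ω, |U ω| ≤ K)
    (hC : ∀ h, 0 ≤ h → ∀ ω, |Z h ω| ≤ C * h)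
    (hlim : Tendsto (fun h => ∫⁻ ω, ‖Z h ω / h - c ω‖ₑ ∂P) (𝓝[>] 0) (𝓝 0)) :
    Tendsto (fun h => ∫⁻ ω, ‖U ω * ((Real.exp (Z h ω) - 1) / h - c ω)‖ₑ ∂P)
      (𝓝[>] 0) (𝓝 0) := by
  have hm : ∀ h : ℝ, Measurable fun ω => ‖Z h ω / h - c ω‖ₑ := fun h =>
    (((hZ h).div_const h).sub hc).enorm
  have hlim' : Tendsto (fun h : ℝ => ENNReal.ofReal K *
      (ENNReal.ofReal (C ^ 2 * h) + ∫⁻ ω, ‖Z h ω / h - c ω‖ₑ ∂P)) (𝓝[>] 0) (𝓝 0) := by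
    have h1 : Tendsto (fun h : ℝ => ENNReal.ofReal (C ^ 2 * h)) (𝓝[>] 0) (𝓝 0) := by
      have : Tendsto (fun h : ℝ => ENNReal.ofReal (C ^ 2 * h)) (𝓝 0)
          (𝓝 (ENNReal.ofReal (C ^ 2 * 0))) :=
        (ENNReal.continuous_ofReal.comp (by fun_prop)).tendsto 0
      rw [mul_zero, ENNReal.ofReal_zero] at this
      exact this.mono_left nhdsWithin_le_nhds
    have := ENNReal.Tendsto.const_mul (a := ENNReal.ofReal K) (h1.add hlim)
      (Or.inr ENNReal.ofReal_ne_top)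
    simpa using this
  refine tendsto_of_tendsto_of_tendsto_of_le_of_le' tendsto_const_nhds hlim'
    (Eventually.of_forall fun _ => zero_le) ?_
  have hδ : 0 < 1 / (|C| + 1) := by positivity
  filter_upwards [Ioc_mem_nhdsGT hδ] with h hh
  have hpt : ∀ ω, ‖U ω * ((Real.exp (Z h ω) - 1) / h - c ω)‖ₑ ≤
      ENNReal.ofReal K * (ENNReal.ofReal (C ^ 2 * h) + ‖Z h ω / h - c ω‖ₑ) := fun ω => by
    have hZh := hC h hh.1.le ω
    have hZ1 : |Z h ω| ≤ 1 := by
      refine hZh.trans ?_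
      have h2 : h * (|C| + 1) ≤ 1 := (le_div_iff₀ (by positivity)).mp hh.2
      nlinarith [hh.1, le_abs_self C]
    have hK : 0 ≤ K := (abs_nonneg _).trans (hU ω)
    rw [← ofReal_norm, ← ofReal_norm, ← ENNReal.ofReal_add
      (mul_nonneg (sq_nonneg C) hh.1.le) (norm_nonneg _), ← ENNReal.ofReal_mul hK]
    refine ENNReal.ofReal_le_ofReal ?_
    rw [norm_mul]
    refine mul_le_mul (hU ω) ((abs_exp_sub_one_div_sub_le hZ1 hh.1).trans ?_)
      (norm_nonneg _) hK
    refine add_le_add ?_ le_rfl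
    rw [div_le_iff₀ hh.1, ← sq_abs]
    calc |Z h ω| ^ 2 ≤ (C * h) ^ 2 := pow_le_pow_left₀ (abs_nonneg _) hZh 2
      _ = C ^ 2 * h * h := by ring
  refine (lintegral_mono hpt).trans (le_of_eq ?_)
  rw [lintegral_const_mul _ (by fun_prop), lintegral_add_left measurable_const]
  simp

/-! ### The Feynman–Kac function in the domain of the generator. -/

namespace MarkovProcess

variable {E Ω : Type*} [MeasurableSpace E] [MeasurableSpace Ω] {M : MarkovProcess E Ω}
  {μ : Measure E} {W : E → ℝ} {B : ℝ}

theorem HasGenerator.const_mul {f g : E → ℝ} (hfg : M.HasGenerator μ f g) (a : ℝ) :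
    M.HasGenerator μ (fun x => a * f x) (fun x => a * g x) := by
  obtain ⟨hf, hg, hlim⟩ := hfg
  refine ⟨hf.const_mul a, hg.const_mul a, ?_⟩
  have h1 : ∀ t : ℝ≥0, eLpNorm (fun x => (M.semigroup t (fun x => a * f x) x - a * f x) / (t : ℝ)
      - a * g x) 2 μ = ‖a‖ₑ *
        eLpNorm (fun x => (M.semigroup t f x - f x) / (t : ℝ) - g x) 2 μ := fun t => by
    rw [← eLpNorm_const_smul]
    congr 1
    ext x
    simp only [semigroup, integral_const_mul, Pi.smul_apply, smul_eq_mul]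
    ring
  simp_rw [h1]
  simpa using ENNReal.Tendsto.const_mul hlim (Or.inr enorm_ne_top)

theorem lintegral_enorm_integral_law_le {Y : Ω → ℝ} (hY : Measurable Y) :
    ∫⁻ x, ‖∫ ω, Y ω ∂(M.law x)‖ₑ ∂μ ≤ ∫⁻ ω, ‖Y ω‖ₑ ∂(M.initLaw μ) := by
  rw [lintegral_initLaw μ hY.enorm]
  exact lintegral_mono fun x => enorm_integral_le_lintegral_enorm _

theorem abs_integral_law_le {Y : Ω → ℝ} {K : ℝ} (hK : ∀ ω, |Y ω| ≤ K) (x : E) :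
    |∫ ω, Y ω ∂(M.law x)| ≤ K := by
  have := norm_integral_le_of_norm_le_const (μ := M.law x) (C := K) (f := Y) (Eventually.of_forall hK)
  simpa using this

/-- A uniform bound turns `L¹` smallness into `L²` smallness, through `‖h‖₂² ≤ K ‖h‖₁`. The
generator needs `𝕃²` limits, while the stationarity argument delivers `L¹` ones. -/
theorem eLpNorm_two_integral_law_le {Y : Ω → ℝ} {K : ℝ} (hY : Measurable Y)
    (hK : ∀ ω, |Y ω| ≤ K) :
    eLpNorm (fun x => ∫ ω, Y ω ∂(M.law x)) 2 μ ≤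
      (ENNReal.ofReal K * ∫⁻ ω, ‖Y ω‖ₑ ∂(M.initLaw μ)) ^ (1 / 2 : ℝ) := by
  rw [eLpNorm_eq_lintegral_rpow_enorm_toReal (by norm_num) (by norm_num)]
  simp only [ENNReal.toReal_ofNat, ENNReal.rpow_ofNat]
  gcongr
  have hm : Measurable fun x => ‖∫ ω, Y ω ∂(M.law x)‖ₑ :=
    (StronglyMeasurable.integral_kernel hY.stronglyMeasurable).measurable.enorm
  calc ∫⁻ x, ‖∫ ω, Y ω ∂(M.law x)‖ₑ ^ 2 ∂μ
      ≤ ∫⁻ x, ENNReal.ofReal K * ‖∫ ω, Y ω ∂(M.law x)‖ₑ ∂μ := by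
        refine lintegral_mono fun x => ?_
        rw [pow_two]
        gcongr
        rw [← ofReal_norm]
        exact ENNReal.ofReal_le_ofReal (abs_integral_law_le hK x)
    _ = ENNReal.ofReal K * ∫⁻ x, ‖∫ ω, Y ω ∂(M.law x)‖ₑ ∂μ := lintegral_const_mul _ hm
    _ ≤ _ := by gcongr; exact lintegral_enorm_integral_law_le hY

theorem pathIntegral_add (hW : Measurable W) (hB : ∀ x, |W x| ≤ B) (a b c : ℝ) (ω : Ω) :
    M.pathIntegral W a b ω + M.pathIntegral W b c ω = M.pathIntegral W a c ω :=
  intervalIntegral.integral_add_adjacent_intervals (intervalIntegrable_path hW hB ω _ _)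
    (intervalIntegrable_path hW hB ω _ _)

/-- The derivative in time of the Feynman-Kac semigroup applied to `1`. -/
noncomputable def feynmanKacDeriv (M : MarkovProcess E Ω) (W : E → ℝ) (t : ℝ) (x : E) : ℝ :=
  ∫ ω, Real.exp (M.pathIntegral W 0 t ω) * W (M.X t.toNNReal ω) ∂(M.law x)

theorem abs_exp_mul_le (hB : ∀ x, |W x| ≤ B) {t : ℝ} (ht : 0 ≤ t) (s : ℝ≥0) (ω : Ω) :
    |Real.exp (M.pathIntegral W 0 t ω) * W (M.X s ω)| ≤ Real.exp (B * t) * B := by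
  rw [abs_mul]
  have := abs_exp_pathIntegral_le (M := M) hB ht ω
  rw [sub_zero] at this
  exact mul_le_mul this (hB _) (abs_nonneg _) (Real.exp_pos _).le

theorem measurable_exp_mul (hW : Measurable W) (t : ℝ) (s : ℝ≥0) :
    Measurable fun ω => Real.exp (M.pathIntegral W 0 t ω) * W (M.X s ω) :=
  (measurable_pathIntegral hW 0 t).exp.mul (hW.comp (M.measurable_eval s))

theorem integrable_exp_mul (hW : Measurable W) (hB : ∀ x, |W x| ≤ B) {t : ℝ} (ht : 0 ≤ t)
    (s : ℝ≥0) (P : Measure Ω) [IsFiniteMeasure P] :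
    Integrable (fun ω => Real.exp (M.pathIntegral W 0 t ω) * W (M.X s ω)) P :=
  Integrable.of_bound (measurable_exp_mul hW t s).aestronglyMeasurable _
    (Eventually.of_forall fun ω => abs_exp_mul_le hB ht s ω)

theorem measurable_feynmanKacDeriv (hW : Measurable W) (t : ℝ) :
    Measurable (M.feynmanKacDeriv W t) :=
  (StronglyMeasurable.integral_kernel
    (measurable_exp_mul (M := M) hW t _).stronglyMeasurable).measurable

theorem abs_feynmanKacDeriv_le (hB : ∀ x, |W x| ≤ B) {t : ℝ} (ht : 0 ≤ t) (x : E) :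
    |M.feynmanKacDeriv W t x| ≤ Real.exp (B * t) * B :=
  abs_integral_law_le (fun ω => abs_exp_mul_le hB ht _ ω) x

theorem abs_feynmanKac_le (hB : ∀ x, |W x| ≤ B) {t : ℝ} (ht : 0 ≤ t) (x : E) :
    |M.feynmanKac W t x| ≤ Real.exp (B * t) := by
  refine abs_integral_law_le (fun ω => ?_) x
  simpa using abs_exp_pathIntegral_le (M := M) hB ht ω

theorem memLp_feynmanKac [IsFiniteMeasure μ] (hW : Measurable W) (hB : ∀ x, |W x| ≤ B) {t : ℝ}
    (ht : 0 ≤ t) : MemLp (M.feynmanKac W t) 2 μ :=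
  MemLp.of_bound (measurable_feynmanKac hW t).aestronglyMeasurable _
    (Eventually.of_forall fun x => abs_feynmanKac_le hB ht x)

theorem memLp_feynmanKacDeriv [IsFiniteMeasure μ] (hW : Measurable W) (hB : ∀ x, |W x| ≤ B)
    {t : ℝ} (ht : 0 ≤ t) : MemLp (M.feynmanKacDeriv W t) 2 μ :=
  MemLp.of_bound (measurable_feynmanKacDeriv hW t).aestronglyMeasurable _
    (Eventually.of_forall fun x => abs_feynmanKacDeriv_le hB ht x)

theorem abs_exp_pathIntegral_zero_le (hB : ∀ x, |W x| ≤ B) {t : ℝ} (ht : 0 ≤ t) (ω : Ω) :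
    |Real.exp (M.pathIntegral W 0 t ω)| ≤ Real.exp (B * t) := by
  simpa using abs_exp_pathIntegral_le (M := M) hB ht ω

theorem abs_pathIntegral_add_le (hB : ∀ x, |W x| ≤ B) (s : ℝ) {h : ℝ} (hh : 0 ≤ h) (ω : Ω) :
    |M.pathIntegral W s (s + h) ω| ≤ B * h := by
  have := abs_pathIntegral_le (M := M) hB s (s + h) ω
  rwa [add_sub_cancel_left, abs_of_nonneg hh] at this

theorem IsInvariant.tendsto_exp_increment [IsProbabilityMeasure μ] (hμ : M.IsInvariant μ)
    (hW : Measurable W) (hB : ∀ x, |W x| ≤ B) {t : ℝ} (ht : 0 ≤ t) :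
    Tendsto (fun h : ℝ => ∫⁻ ω, ‖Real.exp (M.pathIntegral W 0 t ω) *
      ((Real.exp (M.pathIntegral W t (t + h) ω) - 1) / h - W (M.X t.toNNReal ω))‖ₑ
        ∂(M.initLaw μ)) (𝓝[>] 0) (𝓝 0) :=
  tendsto_lintegral_mul_exp_sub_one_div_sub (fun _ => measurable_pathIntegral hW _ _)
    (hW.comp (M.measurable_eval _)) (fun ω => abs_exp_pathIntegral_zero_le hB ht ω)
    (fun _ hh ω => abs_pathIntegral_add_le hB t hh ω) (hμ.tendsto_lintegral_average hW hB ht)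

/-- Moving the time window from `[0, t]` to `[h, t + h]` gains `[t, t + h]` and loses `[0, h]`; this
is the source of the limit `W(X_t) - W(X_0)`. -/
theorem IsInvariant.tendsto_exp_shift [IsProbabilityMeasure μ] (hμ : M.IsInvariant μ)
    (hW : Measurable W) (hB : ∀ x, |W x| ≤ B) {t : ℝ} (ht : 0 ≤ t) :
    Tendsto (fun h : ℝ => ∫⁻ ω, ‖Real.exp (M.pathIntegral W 0 t ω) *
      ((Real.exp (M.pathIntegral W t (t + h) ω - M.pathIntegral W 0 (0 + h) ω) - 1) / h -
        (W (M.X t.toNNReal ω) - W (M.X 0 ω)))‖ₑ ∂(M.initLaw μ))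
      (𝓝[>] 0) (𝓝 0) := by
  have hm : ∀ s h : ℝ, Measurable fun ω =>
      ‖M.pathIntegral W s (s + h) ω / h - W (M.X s.toNNReal ω)‖ₑ := fun s h =>
    (((measurable_pathIntegral hW _ _).div_const h).sub
      (hW.comp (M.measurable_eval _))).enorm
  refine tendsto_lintegral_mul_exp_sub_one_div_sub (C := 2 * B)
    (fun h => (measurable_pathIntegral hW _ _).sub (measurable_pathIntegral hW _ _))
    ((hW.comp (M.measurable_eval _)).sub (hW.comp (M.measurable_eval _)))
    (fun ω => abs_exp_pathIntegral_zero_le hB ht ω) (fun h hh ω => ?_) ?_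
  · refine (abs_sub _ _).trans ?_
    rw [mul_assoc, two_mul]
    exact add_le_add (abs_pathIntegral_add_le hB t hh ω) (abs_pathIntegral_add_le hB 0 hh ω)
  · have hlim := (hμ.tendsto_lintegral_average hW hB ht).add
      (hμ.tendsto_lintegral_average hW hB le_rfl)
    rw [add_zero] at hlim
    refine tendsto_of_tendsto_of_tendsto_of_le_of_le tendsto_const_nhds hlim
      (fun _ => zero_le) fun h => ?_
    beta_reduce
    rw [← lintegral_add_left (hm t h)]
    refine lintegral_mono fun ω => ?_
    have : (M.pathIntegral W t (t + h) ω - M.pathIntegral W 0 (0 + h) ω) / h -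
        (W (M.X t.toNNReal ω) - W (M.X 0 ω)) =
        (M.pathIntegral W t (t + h) ω / h - W (M.X t.toNNReal ω)) -
          (M.pathIntegral W 0 (0 + h) ω / h - W (M.X (0 : ℝ).toNNReal ω)) := by
      rw [Real.toNNReal_zero]; ring
    rw [this]
    exact enorm_sub_le

/-- By the Markov property `P_h u_t` is the expectation of the exponential over the window `[h, t +
h]`, so its difference quotient is governed by the window shift. Gaining the end gives `∂_t u_t`;
losing the beginning gives `- W u_t`, since `X_0 = x`. -/
theorem IsInvariant.hasGenerator_feynmanKac [IsProbabilityMeasure μ] (hμ : M.IsInvariant μ)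
    (hW : Measurable W) (hB : ∀ x, |W x| ≤ B) (h0 : ∀ x, 0 ≤ W x) {t : ℝ} (ht : 0 ≤ t) :
    M.HasGenerator μ (M.feynmanKac W t)
      (fun x => M.feynmanKacDeriv W t x - W x * M.feynmanKac W t x) := by
  have hWm : ∀ s : ℝ≥0, Measurable fun ω => W (M.X s ω) := fun s => hW.comp (M.measurable_eval s)
  refine ⟨memLp_feynmanKac hW hB ht, (memLp_feynmanKacDeriv hW hB ht).sub ?_, ?_⟩
  · refine MemLp.of_bound (hW.mul (measurable_feynmanKac hW t)).aestronglyMeasurable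
      (B * Real.exp (B * t)) (Eventually.of_forall fun x => ?_)
    rw [norm_mul]
    exact mul_le_mul (hB x) (abs_feynmanKac_le hB ht x) (norm_nonneg _)
      ((abs_nonneg _).trans (hB x))
  set Y : ℝ → Ω → ℝ := fun h ω => Real.exp (M.pathIntegral W 0 t ω) *
      ((Real.exp (M.pathIntegral W t (t + h) ω - M.pathIntegral W 0 (0 + h) ω) - 1) / h -
        (W (M.X t.toNNReal ω) - W (M.X 0 ω))) with hY
  have hYm : ∀ h, Measurable (Y h) := fun h =>
    (measurable_pathIntegral hW _ _).exp.mul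
      (((((measurable_pathIntegral hW _ _).sub (measurable_pathIntegral hW _ _)).exp.sub_const
        1).div_const h).sub ((hWm _).sub (hWm _)))
  -- The first term comes from `|exp z - 1| ≤ 2 |z|` with `|z| ≤ 2 B h ≤ 1`, the second from
  -- `|W(X_t) - W(X_0)| ≤ 2 B`.
  set K := Real.exp (B * t) * (2 * (2 * B) + 2 * B) with hK
  have hYK : ∀ h, 0 < h → 2 * B * h ≤ 1 → ∀ ω, |Y h ω| ≤ K := fun h hh hBh ω => by
    have hz : |M.pathIntegral W t (t + h) ω - M.pathIntegral W 0 (0 + h) ω| ≤ 2 * B * h := by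
      refine (abs_sub _ _).trans ?_
      rw [mul_assoc, two_mul]
      exact add_le_add (abs_pathIntegral_add_le hB t hh.le ω)
        (abs_pathIntegral_add_le hB 0 hh.le ω)
    rw [hY, abs_mul]
    refine mul_le_mul (abs_exp_pathIntegral_zero_le hB ht ω) ((abs_sub _ _).trans ?_)
      (abs_nonneg _) (Real.exp_pos _).le
    refine add_le_add ?_ ((abs_sub _ _).trans ?_)
    · rw [abs_div, abs_of_pos hh, div_le_iff₀ hh]
      refine (Real.abs_exp_sub_one_le (hz.trans hBh)).trans ?_
      linarith
    · linarith [hB (M.X t.toNNReal ω), hB (M.X 0 ω)]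
  have hlim : Tendsto (fun h : ℝ => eLpNorm (fun x => ∫ ω, Y h ω ∂(M.law x)) 2 μ)
      (𝓝[>] 0) (𝓝 0) := by
    have h1 := ENNReal.Tendsto.const_mul (a := ENNReal.ofReal K)
      (hμ.tendsto_exp_shift hW hB ht) (Or.inr ENNReal.ofReal_ne_top)
    have h2 := (ENNReal.continuous_rpow_const (y := (1 / 2 : ℝ))).tendsto (ENNReal.ofReal K * 0)
      |>.comp h1
    rw [mul_zero, ENNReal.zero_rpow_of_pos (by norm_num)] at h2
    refine tendsto_of_tendsto_of_tendsto_of_le_of_le' tendsto_const_nhds h2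
      (Eventually.of_forall fun _ => zero_le) ?_
    have hδ : 0 < 1 / (2 * |B| + 1) := by positivity
    filter_upwards [Ioc_mem_nhdsGT hδ] with h hh
    refine eLpNorm_two_integral_law_le (hYm h) (hYK h hh.1 ?_)
    have h2 : h * (2 * |B| + 1) ≤ 1 := (le_div_iff₀ (by positivity)).mp hh.2
    nlinarith [hh.1, le_abs_self B]
  have hcoe : Tendsto (fun h : ℝ≥0 => (h : ℝ)) (𝓝[>] 0) (𝓝[>] 0) := by
    refine tendsto_nhdsWithin_iff.mpr ⟨?_, ?_⟩
    · exact (NNReal.continuous_coe.tendsto 0).mono_left nhdsWithin_le_nhds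
    · filter_upwards [self_mem_nhdsWithin] with h hh
      exact NNReal.coe_pos.mpr hh
  refine (hlim.comp hcoe).congr' ?_
  filter_upwards [self_mem_nhdsWithin] with h hh
  have hh' : (0 : ℝ) < h := NNReal.coe_pos.mpr hh
  simp only [Function.comp_apply]
  congr 1
  ext x
  have hi1 : Integrable (fun ω => Real.exp (M.pathIntegral W h (h + t) ω)) (M.law x) :=
    integrable_exp_pathIntegral hW hB (by linarith) _
  have hi2 : Integrable (fun ω => Real.exp (M.pathIntegral W 0 t ω)) (M.law x) :=
    integrable_exp_pathIntegral hW hB ht _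
  have hi3 := integrable_exp_mul (M := M) hW hB ht t.toNNReal (M.law x)
  rw [semigroup_feynmanKac hW hB h0 x h ht]
  simp only [feynmanKac, feynmanKacDeriv]
  rw [← integral_sub hi1 hi2, ← integral_div, ← integral_const_mul,
    ← integral_sub hi3 (hi2.const_mul _), ← integral_sub (by fun_prop) (by fun_prop)]
  refine integral_congr_ae ((M.start x).mono fun ω hω => ?_)
  have e1 : M.pathIntegral W h (h + t) ω = M.pathIntegral W 0 t ω +
      (M.pathIntegral W t (t + h) ω - M.pathIntegral W 0 (0 + h) ω) := by
    have e2 := pathIntegral_add (M := M) hW hB 0 t (t + h) ω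
    have e3 := pathIntegral_add (M := M) hW hB 0 h (h + t) ω
    rw [zero_add]
    rw [add_comm t] at e2 ⊢
    linarith
  simp only [hY, hω, e1, Real.exp_add]
  ring

end MarkovProcess

/-! ### Growth of the `𝕃²` norm of the Feynman–Kac function. -/

namespace MarkovProcess

variable {E Ω : Type*} [MeasurableSpace E] [MeasurableSpace Ω] {M : MarkovProcess E Ω}
  {μ : Measure E} {W : E → ℝ} {B : ℝ}

theorem abs_feynmanKac_sub_le (hW : Measurable W) (hB : ∀ x, |W x| ≤ B) (h0 : ∀ x, 0 ≤ W x)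
    {s t : ℝ} (hs : 0 ≤ s) (hst : s ≤ t) (x : E) :
    |M.feynmanKac W t x - M.feynmanKac W s x| ≤ B * Real.exp (B * t) * (t - s) := by
  have ht := hs.trans hst
  rw [feynmanKac, feynmanKac, ← integral_sub (integrable_exp_pathIntegral hW hB ht _)
    (integrable_exp_pathIntegral hW hB hs _)]
  refine abs_integral_law_le (fun ω => ?_) x
  have h1 := pathIntegral_add (M := M) hW hB 0 s t ω
  have h2 : 0 ≤ M.pathIntegral W s t ω := pathIntegral_nonneg h0 hst ω
  have h3 : M.pathIntegral W s t ω ≤ B * (t - s) := by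
    have := (le_abs_self _).trans (abs_pathIntegral_le (M := M) hB s t ω)
    rwa [abs_of_nonneg (sub_nonneg.mpr hst)] at this
  have h4 := (le_abs_self _).trans (abs_exp_pathIntegral_zero_le (M := M) hB ht ω)
  have h5 : Real.exp (M.pathIntegral W 0 s ω) =
      Real.exp (M.pathIntegral W 0 t ω) * Real.exp (-M.pathIntegral W s t ω) := by
    rw [← Real.exp_add, ← h1]; congr 1; ring
  have h6 := Real.add_one_le_exp (-M.pathIntegral W s t ω)
  have h7 : Real.exp (-M.pathIntegral W s t ω) ≤ 1 := Real.exp_le_one_iff.mpr (by linarith)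
  have h8 := Real.exp_pos (M.pathIntegral W 0 t ω)
  rw [h5, abs_of_nonneg (by nlinarith)]
  calc _ = Real.exp (M.pathIntegral W 0 t ω) * (1 - Real.exp (-M.pathIntegral W s t ω)) := by ring
    _ ≤ Real.exp (B * t) * (B * (t - s)) :=
        mul_le_mul h4 (by linarith) (by linarith) (Real.exp_pos _).le
    _ = _ := by ring

theorem continuousOn_feynmanKac (hW : Measurable W) (hB : ∀ x, |W x| ≤ B) (h0 : ∀ x, 0 ≤ W x)
    (T : ℝ) (x : E) : ContinuousOn (fun t => M.feynmanKac W t x) (Icc 0 T) := by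
  have hB0 : 0 ≤ B := (h0 x).trans ((le_abs_self _).trans (hB x))
  refine (LipschitzOnWith.of_dist_le_mul (K := (B * Real.exp (B * T)).toNNReal)
    fun s hs t ht => ?_).continuousOn
  wlog hst : t ≤ s generalizing s t
  · rw [dist_comm, dist_comm s]
    exact this t ht s hs (not_le.mp hst).le
  rw [Real.coe_toNNReal _ (by positivity), Real.dist_eq, Real.dist_eq,
    abs_of_nonneg (sub_nonneg.mpr hst)]
  refine (abs_feynmanKac_sub_le hW hB h0 ht.1 hst x).trans ?_
  have := sub_nonneg.mpr hst
  gcongr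
  exact hs.2

theorem one_le_feynmanKac (hW : Measurable W) (hB : ∀ x, |W x| ≤ B) (h0 : ∀ x, 0 ≤ W x)
    {t : ℝ} (ht : 0 ≤ t) (x : E) : 1 ≤ M.feynmanKac W t x := by
  have := integral_mono (μ := M.law x) (integrable_const (1 : ℝ))
    (integrable_exp_pathIntegral hW hB ht _)
    (fun ω => Real.one_le_exp (pathIntegral_nonneg (M := M) h0 ht ω))
  simpa [feynmanKac] using this

theorem integrable_mul_of_bound [IsFiniteMeasure μ] {f g : E → ℝ} {K K' : ℝ} (hf : Measurable f)
    (hg : Measurable g) (hfK : ∀ x, |f x| ≤ K) (hgK : ∀ x, |g x| ≤ K') :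
    Integrable (fun x => f x * g x) μ :=
  Integrable.of_bound (hf.mul hg).aestronglyMeasurable (K * K')
    (Eventually.of_forall fun x => by
      rw [norm_mul]
      exact mul_le_mul (hfK x) (hgK x) (abs_nonneg _) ((abs_nonneg _).trans (hfK x)))

theorem integrable_feynmanKac_sq [IsFiniteMeasure μ] (hW : Measurable W) (hB : ∀ x, |W x| ≤ B)
    {t : ℝ} (ht : 0 ≤ t) : Integrable (fun x => M.feynmanKac W t x ^ 2) μ := by
  simp_rw [pow_two]
  exact integrable_mul_of_bound (measurable_feynmanKac hW t) (measurable_feynmanKac hW t)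
    (abs_feynmanKac_le hB ht) (abs_feynmanKac_le hB ht)

theorem IsInvariant.tendsto_feynmanKac_slope [IsProbabilityMeasure μ] (hμ : M.IsInvariant μ)
    (hW : Measurable W) (hB : ∀ x, |W x| ≤ B) {t : ℝ} (ht : 0 ≤ t) :
    Tendsto (fun h : ℝ => ∫⁻ x, ‖(M.feynmanKac W (t + h) x - M.feynmanKac W t x) / h -
      M.feynmanKacDeriv W t x‖ₑ ∂μ) (𝓝[>] 0) (𝓝 0) := by
  refine tendsto_of_tendsto_of_tendsto_of_le_of_le' tendsto_const_nhds
    (hμ.tendsto_exp_increment hW hB ht) (Eventually.of_forall fun _ => zero_le) ?_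
  filter_upwards [self_mem_nhdsWithin] with h hh
  have hh' : (0 : ℝ) < h := hh
  refine le_trans (le_of_eq ?_) (lintegral_enorm_integral_law_le ?_)
  · refine lintegral_congr fun x => ?_
    have hi1 : Integrable (fun ω => Real.exp (M.pathIntegral W 0 (t + h) ω)) (M.law x) :=
      integrable_exp_pathIntegral hW hB (by linarith) _
    have hi2 : Integrable (fun ω => Real.exp (M.pathIntegral W 0 t ω)) (M.law x) :=
      integrable_exp_pathIntegral hW hB ht _
    have hi3 := integrable_exp_mul (M := M) hW hB ht t.toNNReal (M.law x)
    congr 1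
    simp only [feynmanKac, feynmanKacDeriv]
    rw [← integral_sub hi1 hi2, ← integral_div, ← integral_sub (by fun_prop) hi3]
    refine integral_congr_ae (Eventually.of_forall fun ω => ?_)
    simp only [← pathIntegral_add (M := M) hW hB 0 t (t + h) ω, Real.exp_add]
    ring
  · exact (measurable_pathIntegral hW _ _).exp.mul
      (((((measurable_pathIntegral hW _ _).exp).sub_const 1).div_const h).sub
        (hW.comp (M.measurable_eval _)))

/-- With difference quotient `q = e + v`, the slope of `u²` is `2 u q + h q²`. Here `u` and `q` are
bounded uniformly and `e → 0` in `L¹`, so the error `2 u e + h q²` vanishes in the limit. -/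
theorem IsInvariant.tendsto_integral_feynmanKac_sq_slope [IsProbabilityMeasure μ]
    (hμ : M.IsInvariant μ) (hW : Measurable W) (hB : ∀ x, |W x| ≤ B) (h0 : ∀ x, 0 ≤ W x)
    {t : ℝ} (ht : 0 ≤ t) :
    Tendsto (fun h : ℝ => h⁻¹ * (∫ x, M.feynmanKac W (t + h) x ^ 2 ∂μ -
      ∫ x, M.feynmanKac W t x ^ 2 ∂μ)) (𝓝[>] 0)
      (𝓝 (2 * ∫ x, M.feynmanKac W t x * M.feynmanKacDeriv W t x ∂μ)) := by
  set u := M.feynmanKac W t with hu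
  set v := M.feynmanKacDeriv W t with hv
  set C := Real.exp (B * t) with hC
  set K := B * Real.exp (B * (t + 1)) with hK
  have hum : Measurable u := measurable_feynmanKac hW t
  have hvm : Measurable v := measurable_feynmanKacDeriv hW t
  set e : ℝ → E → ℝ := fun h x => (M.feynmanKac W (t + h) x - u x) / h - v x with he
  have hem : ∀ h, Measurable (e h) := fun h =>
    (((measurable_feynmanKac hW _).sub hum).div_const h).sub hvm
  have hq : ∀ h, 0 < h → h ≤ 1 → ∀ x, |e h x + v x| ≤ K := fun h hh hh1 x => by
    have hB0 : 0 ≤ B := (h0 x).trans ((le_abs_self _).trans (hB x))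
    have := abs_feynmanKac_sub_le (M := M) hW hB h0 ht (by linarith : t ≤ t + h) x
    rw [add_sub_cancel_left] at this
    simp only [he, sub_add_cancel]
    rw [abs_div, abs_of_pos hh, div_le_iff₀ hh]
    refine this.trans ?_
    rw [hK]
    gcongr
  have heb : ∀ h, 0 < h → h ≤ 1 → ∀ x, |e h x| ≤ K + C * B := fun h hh hh1 x => by
    have h1 := hq h hh hh1 x
    have h2 := abs_feynmanKacDeriv_le (M := M) hB ht x
    calc |e h x| = |(e h x + v x) - v x| := by rw [add_sub_cancel_right]
      _ ≤ |e h x + v x| + |v x| := abs_sub _ _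
      _ ≤ _ := add_le_add h1 h2
  have hlim : Tendsto (fun h : ℝ => 2 * C * (∫⁻ x, ‖e h x‖ₑ ∂μ).toReal + h * K ^ 2)
      (𝓝[>] 0) (𝓝 0) := by
    have h1 := (ENNReal.tendsto_toReal ENNReal.zero_ne_top).comp
      (hμ.tendsto_feynmanKac_slope hW hB ht)
    have h2 : Tendsto (fun h : ℝ => h * K ^ 2) (𝓝[>] 0) (𝓝 (0 * K ^ 2)) :=
      ((continuous_id.mul continuous_const).tendsto 0).mono_left nhdsWithin_le_nhds
    simpa using (h1.const_mul (2 * C)).add h2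
  rw [tendsto_iff_norm_sub_tendsto_zero]
  refine tendsto_of_tendsto_of_tendsto_of_le_of_le' tendsto_const_nhds hlim
    (Eventually.of_forall fun _ => norm_nonneg _) ?_
  filter_upwards [Ioc_mem_nhdsGT (zero_lt_one' ℝ)] with h hh
  have hei : Integrable (e h) μ := Integrable.of_bound (hem h).aestronglyMeasurable _
    (Eventually.of_forall (heb h hh.1 hh.2))
  have hi1 := integrable_feynmanKac_sq (M := M) (μ := μ) hW hB (by linarith [hh.1] : 0 ≤ t + h)
  have hi2 := integrable_feynmanKac_sq (M := M) (μ := μ) hW hB ht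
  have hi3 : Integrable (fun x => u x * v x) μ := integrable_mul_of_bound hum hvm
    (abs_feynmanKac_le hB ht) (abs_feynmanKacDeriv_le hB ht)
  rw [← integral_sub hi1 hi2, ← integral_const_mul, ← integral_const_mul,
    ← integral_sub (by fun_prop) (by fun_prop)]
  have hbd : ∀ x, ‖h⁻¹ * (M.feynmanKac W (t + h) x ^ 2 - u x ^ 2) - 2 * (u x * v x)‖ ≤
      2 * C * |e h x| + h * K ^ 2 := fun x => by
    have e1 : M.feynmanKac W (t + h) x = u x + h * (e h x + v x) := by
      simp only [he, sub_add_cancel]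
      rw [mul_div_cancel₀ _ hh.1.ne']; ring
    have e2 : h⁻¹ * (M.feynmanKac W (t + h) x ^ 2 - u x ^ 2) - 2 * (u x * v x) =
        2 * u x * e h x + h * (e h x + v x) ^ 2 := by
      rw [e1]; have := hh.1.ne'; field_simp; ring
    rw [e2]
    refine (norm_add_le _ _).trans (add_le_add ?_ ?_)
    · rw [norm_mul, norm_mul, Real.norm_ofNat, Real.norm_eq_abs, Real.norm_eq_abs]
      gcongr
      exact abs_feynmanKac_le hB ht x
    · rw [norm_mul, norm_pow, Real.norm_of_nonneg hh.1.le, Real.norm_eq_abs]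
      have := hh.1.le
      gcongr
      exact hq h hh.1 hh.2 x
  refine (norm_integral_le_of_norm_le (by fun_prop) (Eventually.of_forall hbd)).trans
    (le_of_eq ?_)
  rw [integral_add (by fun_prop) (by fun_prop), integral_const_mul, integral_const]
  simp only [← Real.norm_eq_abs]
  rw [integral_norm_eq_lintegral_enorm hei.aestronglyMeasurable]
  simp

theorem HasGenerator.form_le_mul {S : ℝ}
    (hS : ∀ f g : E → ℝ, M.HasGenerator μ f g → ∫ x, f x ^ 2 ∂μ = 1 →
      ∫ x, W x * f x ^ 2 ∂μ + ∫ x, g x * f x ∂μ ≤ S) {f g : E → ℝ}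
    (hfg : M.HasGenerator μ f g) (hf : 0 < ∫ x, f x ^ 2 ∂μ) :
    ∫ x, W x * f x ^ 2 ∂μ + ∫ x, g x * f x ∂μ ≤ S * ∫ x, f x ^ 2 ∂μ := by
  set N := ∫ x, f x ^ 2 ∂μ with hN
  set a := (Real.sqrt N)⁻¹ with ha
  have ha2 : a ^ 2 = N⁻¹ := by rw [ha, inv_pow, Real.sq_sqrt hf.le]
  have h1 := hS _ _ (hfg.const_mul a) (by
    simp_rw [mul_pow]
    rw [integral_const_mul, ← hN, ha2, inv_mul_cancel₀ hf.ne'])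
  have e1 : ∀ x, W x * (a * f x) ^ 2 = a ^ 2 * (W x * f x ^ 2) := fun x => by ring
  have e2 : ∀ x, a * g x * (a * f x) = a ^ 2 * (g x * f x) := fun x => by ring
  simp_rw [e1, e2] at h1
  rw [integral_const_mul, integral_const_mul, ← mul_add, ha2, inv_mul_le_iff₀ hf] at h1
  linarith

/-- The `𝕃²` bound for the Feynman-Kac semigroup. -/
theorem IsInvariant.integral_feynmanKac_sq_le [IsProbabilityMeasure μ]
    (hμ : M.IsInvariant μ) (hW : Measurable W) (hB : ∀ x, |W x| ≤ B) (h0 : ∀ x, 0 ≤ W x) {S : ℝ}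
    (hS : ∀ f g : E → ℝ, M.HasGenerator μ f g → ∫ x, f x ^ 2 ∂μ = 1 →
      ∫ x, W x * f x ^ 2 ∂μ + ∫ x, g x * f x ∂μ ≤ S) {t : ℝ} (ht : 0 ≤ t) :
    ∫ x, M.feynmanKac W t x ^ 2 ∂μ ≤ Real.exp (2 * S * t) := by
  set N : ℝ → ℝ := fun t => ∫ x, M.feynmanKac W t x ^ 2 ∂μ with hN
  have hcont : ContinuousOn N (Icc 0 t) := by
    refine continuousOn_of_dominated (bound := fun _ => Real.exp (B * t) ^ 2)
      (fun s _ => ((measurable_feynmanKac hW s).pow_const 2).aestronglyMeasurable)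
      (fun s hs => Eventually.of_forall fun x => ?_) (integrable_const _)
      (Eventually.of_forall fun x => (continuousOn_feynmanKac hW hB h0 t x).pow 2)
    rw [norm_pow]
    refine pow_le_pow_left₀ (norm_nonneg _) ((abs_feynmanKac_le hB hs.1 x).trans ?_) 2
    have hB0 : 0 ≤ B := (h0 x).trans ((le_abs_self _).trans (hB x))
    exact Real.exp_le_exp.mpr (mul_le_mul_of_nonneg_left hs.2 hB0)
  -- Only the right derivative of `N` is available; with continuity, that suffices for Grönwall.
  have hder : ∀ s ∈ Ico 0 t, ∀ r,
      2 * ∫ x, M.feynmanKac W s x * M.feynmanKacDeriv W s x ∂μ < r →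
        ∃ᶠ z in 𝓝[>] s, (z - s)⁻¹ * (N z - N s) < r := fun s hs r hr => by
    have h1 := (hμ.tendsto_integral_feynmanKac_sq_slope hW hB h0 hs.1).eventually_lt_const hr
    have h2 : Tendsto (fun z : ℝ => z - s) (𝓝[>] s) (𝓝[>] 0) := by
      refine tendsto_nhdsWithin_iff.mpr ⟨?_, ?_⟩
      · have : Tendsto (fun z : ℝ => z - s) (𝓝 s) (𝓝 (s - s)) :=
          (continuous_id.sub continuous_const).tendsto s
        rw [sub_self] at this
        exact this.mono_left nhdsWithin_le_nhds
      · filter_upwards [self_mem_nhdsWithin] with z hz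
        exact sub_pos.mpr (mem_Ioi.mp hz)
    refine Eventually.frequently ((h2.eventually h1).mono fun z hz => ?_)
    simpa only [add_sub_cancel] using hz
  have hbd : ∀ s ∈ Ico 0 t, 2 * ∫ x, M.feynmanKac W s x * M.feynmanKacDeriv W s x ∂μ ≤
      2 * S * N s + 0 := fun s hs => by
    -- `W ≥ 0` gives `u_s ≥ 1`, so `u_s` can be normalised.
    have hpos : 0 < N s := by
      have := integral_mono (μ := μ) (integrable_const (1 : ℝ))
        (integrable_feynmanKac_sq hW hB hs.1)
        (fun x => one_le_pow₀ (one_le_feynmanKac (M := M) hW hB h0 hs.1 x))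
      simp only [integral_const, probReal_univ, smul_eq_mul, mul_one] at this
      exact zero_lt_one.trans_le this
    have h1 := HasGenerator.form_le_mul hS (hμ.hasGenerator_feynmanKac hW hB h0 hs.1) hpos
    have hum := measurable_feynmanKac (M := M) hW s
    have hi1 : Integrable (fun x => W x * M.feynmanKac W s x ^ 2) μ := by
      simp_rw [pow_two, ← mul_assoc]
      refine integrable_mul_of_bound (K := B * Real.exp (B * s)) (hW.mul hum) hum (fun x => ?_)
        (abs_feynmanKac_le hB hs.1)
      rw [abs_mul]
      exact mul_le_mul (hB x) (abs_feynmanKac_le hB hs.1 x) (abs_nonneg _)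
        ((abs_nonneg _).trans (hB x))
    have hi2 : Integrable (fun x => M.feynmanKac W s x * M.feynmanKacDeriv W s x) μ :=
      integrable_mul_of_bound hum (measurable_feynmanKacDeriv hW s)
        (abs_feynmanKac_le hB hs.1) (abs_feynmanKacDeriv_le hB hs.1)
    have e1 : ∀ x, (M.feynmanKacDeriv W s x - W x * M.feynmanKac W s x) * M.feynmanKac W s x =
        M.feynmanKac W s x * M.feynmanKacDeriv W s x - W x * M.feynmanKac W s x ^ 2 :=
      fun x => by ring
    simp_rw [e1] at h1
    rw [integral_sub hi2 hi1] at h1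
    linarith
  -- The initial value is `1` because `u_0 = 1` and `μ` is a probability measure.
  have h1 := le_gronwallBound_of_liminf_deriv_right_le (δ := 1) hcont hder
    (by simp [hN, feynmanKac, pathIntegral]) hbd t (right_mem_Icc.mpr ht)
  rwa [gronwallBound_ε0, sub_zero, one_mul] at h1

end MarkovProcess

/-! ### The function `F` is a multiple of the logarithm. -/

/-- A supporting line at `1`: chord slopes to the right of `1` never exceed those to the left, and
`k` is the supremum of the former. -/
theorem ConcaveOn.exists_le_mul_sub_one {F : ℝ → ℝ} (hF_conc : ConcaveOn ℝ (Ioi 0) F)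
    (hF_one : F 1 = 0) : ∃ k, ∀ x, 0 < x → F x ≤ k * (x - 1) := by
  have hslope : ∀ x y, 0 < x → x < 1 → 1 < y → F y / (y - 1) ≤ -F x / (1 - x) := by
    intro x y hx hx1 hy
    have := hF_conc.slope_anti_adjacent (mem_Ioi.mpr hx) (mem_Ioi.mpr (by linarith)) hx1 hy
    rwa [hF_one, sub_zero, zero_sub] at this
  have hbdd : BddAbove ((fun y => F y / (y - 1)) '' Ioi 1) :=
    ⟨-F (1 / 2) / (1 - 1 / 2), by
      rintro _ ⟨y, hy, rfl⟩
      exact hslope _ y (by norm_num) (by norm_num) hy⟩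
  refine ⟨sSup ((fun y => F y / (y - 1)) '' Ioi 1), fun x hx => ?_⟩
  rcases lt_trichotomy x 1 with h | rfl | h
  · have h1 : sSup ((fun y => F y / (y - 1)) '' Ioi 1) ≤ -F x / (1 - x) := by
      refine csSup_le ⟨_, 2, by norm_num, rfl⟩ ?_
      rintro _ ⟨y, hy, rfl⟩
      exact hslope x y hx h hy
    rw [le_div_iff₀ (by linarith)] at h1
    linarith
  · simp [hF_one]
  · have h1 := le_csSup hbdd ⟨x, h, rfl⟩
    beta_reduce at h1
    rwa [div_le_iff₀ (by linarith)] at h1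

/-- A concave increasing function `F` on `]0, +∞[` with `F 1 = 0` and `F (xy) ≤ F x + F y` is a
multiple of the logarithm. -/
theorem exists_eq_mul_log {F : ℝ → ℝ} (hF_mono : StrictMonoOn F (Ioi 0))
    (hF_conc : ConcaveOn ℝ (Ioi 0) F) (hF_one : F 1 = 0)
    (hF_sub : ∀ x y : ℝ, 0 < x → 0 < y → F (x * y) ≤ F x + F y) :
    ∃ k, 0 < k ∧ ∀ x, 0 < x → F x = k * Real.log x := by
  obtain ⟨k, hk⟩ := hF_conc.exists_le_mul_sub_one hF_one
  have hk0 : 0 < k := by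
    have h1 : F 1 < F 2 := hF_mono (mem_Ioi.mpr one_pos) (mem_Ioi.mpr two_pos) one_lt_two
    have h2 := hk 2 two_pos
    linarith
  have hpow : ∀ (u : ℝ) (n : ℕ), F (Real.exp (n * u)) ≤ n * F (Real.exp u) := by
    intro u n
    induction n with
    | zero => simp [hF_one]
    | succ n ih =>
      have h1 := hF_sub _ _ (Real.exp_pos (n * u)) (Real.exp_pos u)
      rw [← Real.exp_add] at h1
      push_cast
      rw [add_mul, add_mul, one_mul, one_mul]
      linarith
  have hupper : ∀ u : ℝ, F (Real.exp u) ≤ k * u := by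
    intro u
    have hlim : Tendsto (fun n : ℕ => k * u + k * u ^ 2 / n) atTop (𝓝 (k * u + 0)) :=
      tendsto_const_nhds.add (tendsto_const_div_atTop_nhds_zero_nat _)
    rw [add_zero] at hlim
    refine ge_of_tendsto hlim ?_
    -- Large enough that `n > 0` and `|u / n| ≤ 1`, the range where `exp v ≤ 1 + v + v²` is used.
    filter_upwards [eventually_ge_atTop (⌈|u|⌉₊ + 1)] with n hn
    have hn0 : (0 : ℝ) < n := by
      have : 0 < n := by omega
      exact_mod_cast this
    have hun : |u| ≤ n := (Nat.le_ceil _).trans (by exact_mod_cast (by omega : ⌈|u|⌉₊ ≤ n))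
    have h1 := hpow (u / n) n
    rw [mul_div_cancel₀ _ hn0.ne'] at h1
    have h2 := hk _ (Real.exp_pos (u / n))
    have h3 : |u / n| ≤ 1 := by
      rw [abs_div, abs_of_pos hn0]; exact (div_le_one hn0).mpr hun
    have h4 := (le_abs_self _).trans (Real.abs_exp_sub_one_sub_id_le h3)
    calc F (Real.exp u) ≤ n * F (Real.exp (u / n)) := h1
      _ ≤ n * (k * (u / n + (u / n) ^ 2)) := by
          refine mul_le_mul_of_nonneg_left (h2.trans ?_) hn0.le
          exact mul_le_mul_of_nonneg_left (by linarith) hk0.le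
      _ = k * u + k * u ^ 2 / n := by field_simp
  refine ⟨k, hk0, fun x hx => ?_⟩
  have h1 := hupper (Real.log x)
  -- The upper bounds at `x` and `1 / x` add up to zero, while subadditivity gives `0 = F 1 ≤ F x +
  -- F (1 / x)`; so both are equalities.
  have h2 := hupper (-Real.log x)
  have h3 := hF_sub _ _ (Real.exp_pos (Real.log x)) (Real.exp_pos (-Real.log x))
  rw [← Real.exp_add, add_neg_cancel, Real.exp_zero, hF_one] at h3
  rw [Real.exp_log hx] at h1 h3
  linarith

/-! ### The functionals attached to `F` in the logarithmic case, and entropy duality. -/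

section LogFunction

variable {E : Type*} [MeasurableSpace E] {μ : Measure E} {F : ℝ → ℝ} {k : ℝ}

theorem valueAtZero_eq_bot (hk : 0 < k) (hF : ∀ x, 0 < x → F x = k * Real.log x) :
    valueAtZero F = ⊥ := by
  rw [valueAtZero, EReal.eq_bot_iff_forall_lt]
  intro y
  refine (iInf_le _ ⟨Real.exp ((y - 1) / k), Real.exp_pos _⟩).trans_lt ?_
  simp only
  rw [hF _ (Real.exp_pos _), Real.log_exp, mul_div_cancel₀ _ hk.ne', EReal.coe_lt_coe_iff]
  linarith

theorem lambdaMax_eq_top (h : valueAtZero F = ⊥) (V : E → ℝ) : lambdaMax μ F V = ⊤ := by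
  rw [lambdaMax, eq_top_iff]
  refine le_sSup fun c _ _ => Eventually.of_forall fun x => ?_
  rw [h]
  exact EReal.bot_lt_coe _

theorem inverseF_eq_exp (hk : 0 < k) (hF : ∀ x, 0 < x → F x = k * Real.log x) (y : ℝ) :
    inverseF F y = Real.exp (y / k) := by
  have hex : ∃ a ∈ Ioi (0 : ℝ), F a = y :=
    ⟨Real.exp (y / k), Real.exp_pos _, by
      rw [hF _ (Real.exp_pos _), Real.log_exp, mul_div_cancel₀ _ hk.ne']⟩
  have h1 : 0 < inverseF F y := Function.invFunOn_mem hex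
  have h2 : F (inverseF F y) = y := Function.invFunOn_eq hex
  rw [hF _ h1] at h2
  rw [show y / k = Real.log (inverseF F y) by rw [div_eq_iff hk.ne', mul_comm, h2],
    Real.exp_log h1]

theorem integrable_exp_div_of_bound [IsFiniteMeasure μ] (hk : 0 < k) {W : E → ℝ} {B : ℝ}
    (hW : Measurable W) (hB : ∀ x, |W x| ≤ B) : Integrable (fun x => Real.exp (W x / k)) μ := by
  refine Integrable.of_bound (hW.div_const k).exp.aestronglyMeasurable (Real.exp (B / k))
    (Eventually.of_forall fun x => ?_)
  rw [Real.norm_of_nonneg (Real.exp_pos _).le]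
  exact Real.exp_le_exp.mpr (div_le_div_of_nonneg_right ((le_abs_self _).trans (hB x)) hk.le)

theorem sobolevFunctional_eq [IsProbabilityMeasure μ] (hk : 0 < k)
    (hF : ∀ x, 0 < x → F x = k * Real.log x) {W : E → ℝ}
    (hInt : Integrable (fun x => Real.exp (W x / k)) μ) :
    sobolevFunctional μ F W = ((k * Real.log (∫ x, Real.exp (W x / k) ∂μ) : ℝ) : EReal) := by
  have hpos := integral_exp_pos hInt
  have h1 : ∫⁻ x, ENNReal.ofReal (inverseF F (W x)) ∂μ =
      ENNReal.ofReal (∫ x, Real.exp (W x / k) ∂μ) := by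
    simp_rw [inverseF_eq_exp hk hF]
    exact (ofReal_integral_eq_lintegral_ofReal hInt
      (Eventually.of_forall fun _ => (Real.exp_pos _).le)).symm
  rw [sobolevFunctional, h1, extendF, if_neg (ENNReal.ofReal_pos.mpr hpos).ne',
    if_neg ENNReal.ofReal_ne_top, ENNReal.toReal_ofReal hpos.le, hF _ hpos]

theorem sobolevFunctional_eq_top (hk : 0 < k)
    (hF : ∀ x, 0 < x → F x = k * Real.log x) {W : E → ℝ} (hW : Measurable W)
    (hInt : ¬ Integrable (fun x => Real.exp (W x / k)) μ) : sobolevFunctional μ F W = ⊤ := by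
  have h1 : ∫⁻ x, ENNReal.ofReal (inverseF F (W x)) ∂μ = ∞ := by
    simp_rw [inverseF_eq_exp hk hF]
    by_contra h
    exact hInt (lintegral_ofReal_ne_top_iff_integrable
      (hW.div_const k).exp.aestronglyMeasurable
      (Eventually.of_forall fun _ => (Real.exp_pos _).le) |>.mp h)
  rw [sobolevFunctional, h1, extendF, if_neg ENNReal.top_ne_zero, if_pos rfl]

/-- Young's inequality for entropy: `log y ≤ y - 1` at `y = exp (w / k) / (s Z)`, multiplied by `k
s`. For `Z = ∫ exp (W / k) dμ` and `∫ s dμ = 1`, the last two terms integrate to exactly `k log Z`.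
-/
theorem mul_le_mul_log_add (hk : 0 < k) (hF : ∀ x, 0 < x → F x = k * Real.log x) (w : ℝ)
    {s Z : ℝ} (hs : 0 ≤ s) (hZ : 0 < Z) :
    w * s ≤ s * F s + k * (Real.log Z - 1) * s + k / Z * Real.exp (w / k) := by
  rcases hs.eq_or_lt with rfl | hs
  · simp only [mul_zero, zero_mul, zero_add]
    positivity
  · have h1 := Real.log_le_sub_one_of_pos (div_pos (Real.exp_pos (w / k)) (mul_pos hs hZ))
    rw [Real.log_div (Real.exp_pos _).ne' (mul_pos hs hZ).ne', Real.log_exp,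
      Real.log_mul hs.ne' hZ.ne'] at h1
    have h2 := mul_le_mul_of_nonneg_left h1 (mul_pos hk hs).le
    have e1 : k * s * (w / k - (Real.log s + Real.log Z)) =
        w * s - s * (k * Real.log s) - k * s * Real.log Z := by
      field_simp; ring
    have e2 : k * s * (Real.exp (w / k) / (s * Z) - 1) =
        k / Z * Real.exp (w / k) - k * s := by field_simp
    rw [e1, e2] at h2
    rw [hF s hs]
    linarith

/-- The majorant makes the positive part finite, so `∞ - ∞` cannot occur; an infinite negative part
only makes the left side `-∞`. -/
theorem lintegral_ofReal_sub_lintegral_ofReal_neg_le {φ Φ : E → ℝ} (hφ : AEStronglyMeasurable φ μ)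
    (hΦ : Integrable Φ μ) (h : ∀ x, φ x ≤ Φ x) :
    ((∫⁻ x, ENNReal.ofReal (φ x) ∂μ : ℝ≥0∞) : EReal) -
      ((∫⁻ x, ENNReal.ofReal (-φ x) ∂μ : ℝ≥0∞) : EReal) ≤ ((∫ x, Φ x ∂μ : ℝ) : EReal) := by
  have hpos : ∫⁻ x, ENNReal.ofReal (φ x) ∂μ ≠ ∞ :=
    ((lintegral_mono fun x => ENNReal.ofReal_le_ofReal (h x)).trans_lt
      hΦ.lintegral_lt_top).ne
  by_cases hneg : ∫⁻ x, ENNReal.ofReal (-φ x) ∂μ = ∞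
  · rw [hneg, EReal.coe_ennreal_top, EReal.sub_top]
    exact bot_le
  · have hInt : Integrable φ μ := by
      refine ⟨hφ, ?_⟩
      have h1 : ∀ x, ‖φ x‖ₑ ≤ ENNReal.ofReal (φ x) + ENNReal.ofReal (-φ x) := fun x => by
        rcases le_total 0 (φ x) with h0 | h0
        · rw [Real.enorm_of_nonneg h0]; exact le_self_add
        · rw [← enorm_neg, Real.enorm_of_nonneg (neg_nonneg.mpr h0)]; exact le_add_self
      refine (lintegral_mono h1).trans_lt ?_
      rw [lintegral_add_left' hφ.aemeasurable.ennreal_ofReal]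
      exact ENNReal.add_lt_top.mpr ⟨hpos.lt_top, (Ne.lt_top hneg)⟩
    rw [← ENNReal.ofReal_toReal hpos, ← ENNReal.ofReal_toReal hneg,
      EReal.coe_ennreal_ofReal, EReal.coe_ennreal_ofReal, max_eq_left ENNReal.toReal_nonneg,
      max_eq_left ENNReal.toReal_nonneg, ← EReal.coe_sub, EReal.coe_le_coe_iff,
      ← integral_eq_lintegral_pos_part_sub_lintegral_neg_part hInt]
    exact integral_mono hInt hΦ h

end LogFunction

/-! ### The bound on `Λ` from the `F`-Sobolev inequality. -/

namespace MarkovProcess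

variable {E Ω : Type*} [MeasurableSpace E] [MeasurableSpace Ω] {M : MarkovProcess E Ω}
  {μ : Measure E} {F : ℝ → ℝ} {k : ℝ}

/-- The majorant itself is exposed because `W f²` need not be integrable. It is integrable thanks to
the integrability clause in `FSobolev`. -/
theorem FSobolev.exists_integrable_bound [IsProbabilityMeasure μ] (hSob : M.FSobolev μ F)
    (hk : 0 < k) (hF : ∀ x, 0 < x → F x = k * Real.log x) {W : E → ℝ}
    (hInt : Integrable (fun x => Real.exp (W x / k)) μ) {f g : E → ℝ}
    (hfg : M.HasGenerator μ f g) (hf : ∫ x, f x ^ 2 ∂μ = 1) :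
    ∃ Φ : E → ℝ, Integrable Φ μ ∧ (∀ x, W x * f x ^ 2 ≤ Φ x) ∧
      ∫ x, Φ x ∂μ + ∫ x, g x * f x ∂μ ≤ k * Real.log (∫ x, Real.exp (W x / k) ∂μ) := by
  obtain ⟨h1, h2⟩ := hSob f g hfg hf
  set Z := ∫ x, Real.exp (W x / k) ∂μ with hZ
  have hZ0 : 0 < Z := integral_exp_pos hInt
  have hf2 : Integrable (fun x => f x ^ 2) μ := hfg.1.integrable_sq
  refine ⟨_, ((h1.add (hf2.const_mul (k * (Real.log Z - 1)))).add (hInt.const_mul (k / Z))),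
    fun x => mul_le_mul_log_add hk hF (W x) (sq_nonneg (f x)) hZ0, ?_⟩
  rw [integral_add' (h1.add (hf2.const_mul _)) (hInt.const_mul _),
    integral_add' h1 (hf2.const_mul _), integral_const_mul, integral_const_mul, hf, ← hZ,
    div_mul_cancel₀ _ hZ0.ne']
  linarith

theorem FSobolev.Lam_le [IsProbabilityMeasure μ] (hSob : M.FSobolev μ F)
    (hk : 0 < k) (hF : ∀ x, 0 < x → F x = k * Real.log x) {W : E → ℝ} (hW : Measurable W) :
    M.Lam μ W ≤ sobolevFunctional μ F W := by
  by_cases hInt : Integrable (fun x => Real.exp (W x / k)) μ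
  · rw [sobolevFunctional_eq hk hF hInt]
    refine sSup_le ?_
    rintro r ⟨f, g, hfg, hf, rfl⟩
    obtain ⟨Φ, hΦ, hle, hbd⟩ := hSob.exists_integrable_bound hk hF hInt hfg hf
    have hφ : AEStronglyMeasurable (fun x => W x * f x ^ 2) μ :=
      hW.aestronglyMeasurable.mul (hfg.1.aestronglyMeasurable.pow 2)
    refine (add_le_add_left (lintegral_ofReal_sub_lintegral_ofReal_neg_le hφ hΦ hle) _).trans ?_
    rw [← EReal.coe_add, EReal.coe_le_coe_iff]
    exact hbd
  · rw [sobolevFunctional_eq_top hk hF hW hInt]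
    exact le_top

theorem FSobolev.form_le [IsProbabilityMeasure μ] (hSob : M.FSobolev μ F)
    (hk : 0 < k) (hF : ∀ x, 0 < x → F x = k * Real.log x) {W : E → ℝ} {B : ℝ}
    (hW : Measurable W) (hB : ∀ x, |W x| ≤ B) {f g : E → ℝ} (hfg : M.HasGenerator μ f g)
    (hf : ∫ x, f x ^ 2 ∂μ = 1) :
    ∫ x, W x * f x ^ 2 ∂μ + ∫ x, g x * f x ∂μ ≤ k * Real.log (∫ x, Real.exp (W x / k) ∂μ) := by
  have hInt := integrable_exp_div_of_bound (μ := μ) hk hW hB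
  obtain ⟨Φ, hΦ, hle, hbd⟩ := hSob.exists_integrable_bound hk hF hInt hfg hf
  have hWf : Integrable (fun x => W x * f x ^ 2) μ :=
    hfg.1.integrable_sq.bdd_mul hW.aestronglyMeasurable (Eventually.of_forall hB)
  linarith [integral_mono hWf hΦ hle]

end MarkovProcess

/-! ### Centring does not change the rate function. -/

section Centering

variable {E : Type*} [MeasurableSpace E] {μ : Measure E} {F : ℝ → ℝ} {k : ℝ}

theorem sobolevFunctional_sub_const [IsProbabilityMeasure μ] (hk : 0 < k)
    (hF : ∀ x, 0 < x → F x = k * Real.log x) {W : E → ℝ} (hW : Measurable W) (m : ℝ) :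
    sobolevFunctional μ F (fun x => W x - m) = sobolevFunctional μ F W - (m : EReal) := by
  have e1 : ∀ x, Real.exp ((W x - m) / k) = Real.exp (-(m / k)) * Real.exp (W x / k) := fun x => by
    rw [← Real.exp_add]; congr 1; ring
  by_cases hInt : Integrable (fun x => Real.exp (W x / k)) μ
  · have hInt' : Integrable (fun x => Real.exp ((W x - m) / k)) μ := by
      simp_rw [e1]; exact hInt.const_mul _
    rw [sobolevFunctional_eq hk hF hInt, sobolevFunctional_eq hk hF hInt', ← EReal.coe_sub]
    simp_rw [e1]
    rw [integral_const_mul, Real.log_mul (Real.exp_pos _).ne' (integral_exp_pos hInt).ne',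
      Real.log_exp]
    congr 1
    field_simp
    ring
  · have hInt' : ¬ Integrable (fun x => Real.exp ((W x - m) / k)) μ := fun h => hInt (by
      refine (h.const_mul (Real.exp (m / k))).congr (Eventually.of_forall fun x => ?_)
      beta_reduce
      rw [← Real.exp_add]; congr 1; ring)
    rw [sobolevFunctional_eq_top hk hF hW hInt,
      sobolevFunctional_eq_top hk hF (hW.sub_const m) hInt', EReal.top_sub_coe]

/-- Centring lowers both `λ a` and `k log ∫ exp (λ V / k) dμ` by `λ ∫ V dμ`, and these cancel for
each `λ`; no `λ` is excluded on either side since `λ_V = +∞` always. -/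
theorem HstarC_eq_Hstar [IsProbabilityMeasure μ] (hk : 0 < k)
    (hF : ∀ x, 0 < x → F x = k * Real.log x) {V : E → ℝ} (hV : Measurable V) (R : ℝ) :
    HstarC μ F V R = Hstar μ F V (R + ∫ x, V x ∂μ) := by
  have hbot := valueAtZero_eq_bot hk hF
  rw [HstarC, Hstar, Hstar, lambdaMax_eq_top hbot, lambdaMax_eq_top hbot]
  refine iSup_congr fun c => iSup_congr fun _ => ?_
  simp_rw [mul_sub]
  rw [sobolevFunctional_sub_const hk hF (hV.const_mul c), mul_add]
  generalize sobolevFunctional μ F (fun x => c * V x) = S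
  induction S with
  | bot => rw [EReal.bot_sub, EReal.coe_sub_bot, EReal.coe_sub_bot]
  | top => rw [EReal.top_sub_coe, EReal.sub_top, EReal.sub_top]
  | coe s =>
    rw [← EReal.coe_sub, ← EReal.coe_sub, ← EReal.coe_sub]
    congr 1; ring

end Centering

/-! ### Change of initial law and optimisation over the parameter. -/

section DensityNorm

variable {E : Type*} [MeasurableSpace E] {μ ν : Measure E}

theorem densityNorm_eq [IsProbabilityMeasure ν] :
    densityNorm ν μ = (∫⁻ x, ν.rnDeriv μ x ^ (2 : ℝ) ∂μ) ^ (1 / 2 : ℝ) := by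
  rw [densityNorm, eLpNorm_eq_lintegral_rpow_enorm_toReal (by norm_num) (by norm_num)]
  simp only [ENNReal.toReal_ofNat]
  congr 1
  refine lintegral_congr_ae ((Measure.rnDeriv_lt_top ν μ).mono fun x hx => ?_)
  beta_reduce
  rw [Real.enorm_of_nonneg ENNReal.toReal_nonneg, ENNReal.ofReal_toReal hx.ne]

theorem densityNorm_ne_zero [IsProbabilityMeasure μ] [IsProbabilityMeasure ν] (hν : ν ≪ μ) :
    densityNorm ν μ ≠ 0 := by
  rw [densityNorm_eq]
  intro h
  rw [ENNReal.rpow_eq_zero_iff_of_pos (by norm_num),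
    lintegral_eq_zero_iff ((Measure.measurable_rnDeriv ν μ).pow_const _)] at h
  have h1 : ν.rnDeriv μ =ᵐ[μ] 0 := h.mono fun x hx => by
    simpa using (ENNReal.rpow_eq_zero_iff_of_pos (by norm_num)).mp hx
  have h2 := Measure.withDensity_rnDeriv_eq ν μ hν
  rw [withDensity_congr_ae h1, withDensity_zero] at h2
  exact IsProbabilityMeasure.ne_zero ν h2.symm

theorem densityNorm_self [IsProbabilityMeasure μ] : densityNorm μ μ = 1 := by
  rw [densityNorm_eq, lintegral_congr_ae (g := fun _ => 1)
    ((Measure.rnDeriv_self μ).mono fun x hx => by simp [hx])]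
  simp

theorem lintegral_le_densityNorm_mul [IsProbabilityMeasure μ] [IsProbabilityMeasure ν]
    (hν : ν ≪ μ) {u : E → ℝ} (hu : Measurable u) (h0 : ∀ x, 0 ≤ u x)
    (hInt : Integrable (fun x => u x ^ 2) μ) :
    ∫⁻ x, ENNReal.ofReal (u x) ∂ν ≤
      densityNorm ν μ * ENNReal.ofReal (∫ x, u x ^ 2 ∂μ) ^ (1 / 2 : ℝ) := by
  rw [← lintegral_rnDeriv_mul hν hu.ennreal_ofReal.aemeasurable, densityNorm_eq,
    ofReal_integral_eq_lintegral_ofReal hInt (Eventually.of_forall fun x => sq_nonneg _)]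
  have h1 := ENNReal.lintegral_mul_le_Lp_mul_Lq μ Real.HolderConjugate.two_two
    (Measure.measurable_rnDeriv ν μ).aemeasurable hu.ennreal_ofReal.aemeasurable
  have h2 : ∀ x, ENNReal.ofReal (u x) ^ (2 : ℝ) = ENNReal.ofReal (u x ^ 2) := fun x => by
    rw [ENNReal.rpow_ofNat, ENNReal.ofReal_pow (h0 x)]
  simp_rw [h2] at h1
  exact h1

end DensityNorm

/-- Dividing by `D` and taking logarithms turns each hypothesis into an upper bound on `h i`
independent of `i`, which passes to the supremum even if that is infinite or not attained. -/
theorem ENNReal.le_mul_exp_neg_mul_iSup₂ {ι : Type*} {p : ι → Prop} {h : ι → EReal} {P D : ℝ≥0∞}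
    {t : ℝ} (ht : 0 < t) (hD0 : D ≠ 0) (hD : D ≠ ∞)
    (hle : ∀ i, p i → P ≤ D * EReal.exp (-((t : EReal) * h i))) :
    P ≤ D * EReal.exp (-((t : EReal) * ⨆ (i) (_ : p i), h i)) := by
  have ht1 : (0 : EReal) < t := EReal.coe_pos.mpr ht
  rw [mul_comm D, ← ENNReal.div_le_iff_le_mul (Or.inl hD0) (Or.inl hD)]
  have h1 : ∀ i, p i → h i ≤ -(P / D).log / (t : EReal) := fun i hi => by
    have h2 := hle i hi
    rw [mul_comm D, ← ENNReal.div_le_iff_le_mul (Or.inl hD0) (Or.inl hD),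
      ← ENNReal.exp_log (P / D), EReal.exp_le_exp_iff] at h2
    rw [EReal.le_div_iff_mul_le ht1 (EReal.coe_ne_top t), mul_comm]
    exact EReal.le_neg_of_le_neg h2
  have h3 := iSup₂_le h1
  rw [EReal.le_div_iff_mul_le ht1 (EReal.coe_ne_top t), mul_comm] at h3
  rw [← ENNReal.exp_log (P / D), EReal.exp_le_exp_iff]
  exact EReal.le_neg_of_le_neg h3

/-! ### Exponential moments and the deviation bounds. -/

namespace MarkovProcess

variable {E Ω : Type*} [MeasurableSpace E] [MeasurableSpace Ω] {M : MarkovProcess E Ω}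
  {μ ν : Measure E} {F : ℝ → ℝ} {k : ℝ} {W V : E → ℝ} {B : ℝ}

theorem IsInvariant.lintegral_exp_pathIntegral_le_of_nonneg [IsProbabilityMeasure μ]
    [IsProbabilityMeasure ν] (hμ : M.IsInvariant μ) (hν : ν ≪ μ) (hW : Measurable W)
    (hB : ∀ x, |W x| ≤ B) (h0 : ∀ x, 0 ≤ W x) {S : ℝ}
    (hS : ∀ f g : E → ℝ, M.HasGenerator μ f g → ∫ x, f x ^ 2 ∂μ = 1 →
      ∫ x, W x * f x ^ 2 ∂μ + ∫ x, g x * f x ∂μ ≤ S) {t : ℝ} (ht : 0 ≤ t) :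
    ∫⁻ ω, ENNReal.ofReal (Real.exp (M.pathIntegral W 0 t ω)) ∂(M.initLaw ν) ≤
      densityNorm ν μ * ENNReal.ofReal (Real.exp (t * S)) := by
  rw [lintegral_initLaw ν (measurable_pathIntegral hW 0 t).exp.ennreal_ofReal]
  simp_rw [← ofReal_feynmanKac (M := M) hW hB ht]
  refine (lintegral_le_densityNorm_mul hν (measurable_feynmanKac hW t) (feynmanKac_nonneg t)
    (integrable_feynmanKac_sq hW hB ht)).trans ?_
  gcongr
  calc ENNReal.ofReal (∫ x, M.feynmanKac W t x ^ 2 ∂μ) ^ (1 / 2 : ℝ)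
      ≤ ENNReal.ofReal (Real.exp (2 * S * t)) ^ (1 / 2 : ℝ) := by
        gcongr
        exact hμ.integral_feynmanKac_sq_le hW hB h0 hS ht
    _ = ENNReal.ofReal (Real.exp (t * S)) := by
        rw [ENNReal.ofReal_rpow_of_pos (Real.exp_pos _), ← Real.exp_mul]
        congr 2; ring

theorem FSobolev.lintegral_exp_pathIntegral_le [IsProbabilityMeasure μ]
    [IsProbabilityMeasure ν] (hSob : M.FSobolev μ F) (hk : 0 < k)
    (hF : ∀ x, 0 < x → F x = k * Real.log x) (hμ : M.IsInvariant μ) (hν : ν ≪ μ)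
    (hW : Measurable W) (hB : ∀ x, |W x| ≤ B) {t : ℝ} (ht : 0 ≤ t) :
    ∫⁻ ω, ENNReal.ofReal (Real.exp (M.pathIntegral W 0 t ω)) ∂(M.initLaw ν) ≤
      densityNorm ν μ *
        ENNReal.ofReal (Real.exp (t * (k * Real.log (∫ x, Real.exp (W x / k) ∂μ)))) := by
  have hInt := integrable_exp_div_of_bound (μ := μ) hk hW hB
  set S := k * Real.log (∫ x, Real.exp (W x / k) ∂μ) with hS
  -- Adding `B` makes the potential nonnegative and multiplies both sides of the bound by `exp (t
  -- B)`.
  have hW' : Measurable fun x => W x + B := hW.add_const B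
  have hB' : ∀ x, |W x + B| ≤ 2 * B := fun x => by
    have := abs_le.mp (hB x)
    rw [abs_le]; constructor <;> linarith
  have hS' : k * Real.log (∫ x, Real.exp ((W x + B) / k) ∂μ) = S + B := by
    have e1 : ∀ x, Real.exp ((W x + B) / k) = Real.exp (B / k) * Real.exp (W x / k) :=
      fun x => by rw [← Real.exp_add]; congr 1; ring
    simp_rw [e1]
    rw [integral_const_mul, Real.log_mul (Real.exp_pos _).ne' (integral_exp_pos hInt).ne',
      Real.log_exp, mul_add, mul_div_cancel₀ _ hk.ne', add_comm]
  have hpath : ∀ ω, M.pathIntegral (fun x => W x + B) 0 t ω = M.pathIntegral W 0 t ω + t * B :=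
    fun ω => by
      rw [pathIntegral, intervalIntegral.integral_add (intervalIntegrable_path hW hB ω 0 t)
        intervalIntegrable_const]
      simp [pathIntegral]
  have hmain := hμ.lintegral_exp_pathIntegral_le_of_nonneg hν hW' hB'
    (fun x => by linarith [(abs_le.mp (hB x)).1])
    (fun f g hfg hf => hSob.form_le hk hF hW' hB' hfg hf) ht
  rw [hS'] at hmain
  simp_rw [hpath, Real.exp_add, ENNReal.ofReal_mul (Real.exp_pos _).le] at hmain
  rw [lintegral_mul_const _ (measurable_pathIntegral hW 0 t).exp.ennreal_ofReal, mul_add,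
    Real.exp_add, ENNReal.ofReal_mul (Real.exp_pos _).le, ← mul_assoc] at hmain
  exact (ENNReal.mul_le_mul_iff_left (ENNReal.ofReal_pos.mpr (Real.exp_pos _)).ne'
    ENNReal.ofReal_ne_top).mp hmain

/-- Under `ℙ_μ` the expected integral of `|V|` along the path is `t ‖V‖₁ < ∞`; null sets pass to
`ℙ_ν` since `ν ≪ μ`. -/
theorem IsInvariant.ae_intervalIntegrable_path [IsProbabilityMeasure μ] (hμ : M.IsInvariant μ)
    (hν : ν ≪ μ) (hV : Measurable V) (hInt : Integrable V μ) {t : ℝ} (ht : 0 ≤ t) :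
    ∀ᵐ ω ∂(M.initLaw ν), IntervalIntegrable (fun s : ℝ => V (M.X s.toNNReal ω)) volume 0 t := by
  have hac : M.initLaw ν ≪ M.initLaw μ := hν.comp_right M.law
  refine hac.ae_le ?_
  have hm : Measurable fun p : Ω × ℝ => ‖V (M.X p.2.toNNReal p.1)‖ₑ :=
    ((M.measurable_path hV).comp measurable_swap).enorm
  have hfin : ∫⁻ ω, ∫⁻ s in Ioc 0 t, ‖V (M.X s.toNNReal ω)‖ₑ ∂volume ∂(M.initLaw μ) ≠ ∞ := by
    rw [lintegral_lintegral_swap hm.aemeasurable]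
    have h1 : ∀ s : ℝ, ∫⁻ ω, ‖V (M.X s.toNNReal ω)‖ₑ ∂(M.initLaw μ) = ∫⁻ x, ‖V x‖ₑ ∂μ :=
      fun s => by
        conv_rhs => rw [← hμ.map_eval s.toNNReal, lintegral_map hV.enorm (M.measurable_eval _)]
    simp_rw [h1]
    rw [setLIntegral_const]
    exact ENNReal.mul_ne_top hInt.2.ne (by simp)
  filter_upwards [ae_lt_top hm.lintegral_prod_right' hfin] with ω hω
  rw [intervalIntegrable_iff_integrableOn_Ioc_of_le ht]
  exact ⟨((M.measurable_path hV).comp measurable_prodMk_right).aestronglyMeasurable, hω⟩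

theorem FSobolev.lintegral_exp_mul_pathIntegral_le [IsProbabilityMeasure μ]
    [IsProbabilityMeasure ν] (hSob : M.FSobolev μ F) (hk : 0 < k)
    (hF : ∀ x, 0 < x → F x = k * Real.log x) (hμ : M.IsInvariant μ) (hν : ν ≪ μ)
    (hV : Measurable V) (hInt : Integrable V μ)
    (hexp : Integrable (fun x => Real.exp (V x / k)) μ) {t : ℝ} (ht : 0 ≤ t) :
    ∫⁻ ω, ENNReal.ofReal (Real.exp (M.pathIntegral V 0 t ω)) ∂(M.initLaw ν) ≤
      densityNorm ν μ *
        ENNReal.ofReal (Real.exp (t * (k * Real.log (∫ x, Real.exp (V x / k) ∂μ)))) := by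
  -- Two-sided truncation. The right side converges by dominated convergence with majorant `exp (V /
  -- k) + 1`; the left side is handled by Fatou along almost every path.
  set W : ℕ → E → ℝ := fun n x => max (-(n : ℝ)) (min (V x) n) with hWdef
  have hW : ∀ n, Measurable (W n) := fun n => measurable_const.max (hV.min measurable_const)
  have hB : ∀ n x, |W n x| ≤ n := fun n x =>
    abs_le.mpr ⟨le_max_left _ _, max_le (by linarith [n.cast_nonneg (α := ℝ)]) (min_le_right _ _)⟩
  have hWV : ∀ n x, |W n x| ≤ |V x| := fun n x => by
    have hn : (0 : ℝ) ≤ n := n.cast_nonneg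
    refine abs_le.mpr ⟨?_, max_le (by linarith [abs_nonneg (V x)])
      ((min_le_left _ _).trans (le_abs_self _))⟩
    refine le_trans ?_ (le_max_right _ _)
    exact le_min (neg_abs_le _) (by linarith [abs_nonneg (V x)])
  have hWlim : ∀ x, Tendsto (fun n => W n x) atTop (𝓝 (V x)) := fun x => by
    refine tendsto_const_nhds.congr' ?_
    filter_upwards [eventually_ge_atTop ⌈|V x|⌉₊] with n hn
    have h1 : |V x| ≤ n := (Nat.le_ceil _).trans (by exact_mod_cast hn)
    rw [hWdef]
    beta_reduce
    rw [min_eq_left (le_of_abs_le h1), max_eq_right (neg_le_of_abs_le h1)]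
  have hZlim : Tendsto (fun n => ∫ x, Real.exp (W n x / k) ∂μ) atTop
      (𝓝 (∫ x, Real.exp (V x / k) ∂μ)) := by
    refine tendsto_integral_of_dominated_convergence (fun x => Real.exp (V x / k) + 1)
      (fun n => ((hW n).div_const k).exp.aestronglyMeasurable) (hexp.add (integrable_const 1))
      (fun n => Eventually.of_forall fun x => ?_)
      (Eventually.of_forall fun x => ((hWlim x).div_const k).rexp)
    rw [Real.norm_of_nonneg (Real.exp_pos _).le]
    rcases le_total 0 (V x) with h | h
    · have h1 : W n x ≤ V x := by
        have := hWV n x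
        rw [abs_of_nonneg h] at this
        exact (le_abs_self _).trans this
      have := Real.exp_le_exp.mpr (div_le_div_of_nonneg_right h1 hk.le)
      linarith
    · have h1 : W n x ≤ 0 := max_le (by linarith [n.cast_nonneg (α := ℝ)])
        ((min_le_left _ _).trans h)
      have := Real.exp_le_one_iff.mpr (div_nonpos_of_nonpos_of_nonneg h1 hk.le)
      linarith [Real.exp_pos (V x / k)]
  have hlim : Tendsto (fun n => densityNorm ν μ * ENNReal.ofReal
      (Real.exp (t * (k * Real.log (∫ x, Real.exp (W n x / k) ∂μ))))) atTop
      (𝓝 (densityNorm ν μ *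
        ENNReal.ofReal (Real.exp (t * (k * Real.log (∫ x, Real.exp (V x / k) ∂μ)))))) := by
    -- The norm may be infinite; multiplication by it still preserves the limit because the limit is
    -- nonzero.
    refine ENNReal.Tendsto.const_mul (ENNReal.tendsto_ofReal ?_)
      (Or.inl (ENNReal.ofReal_pos.mpr (Real.exp_pos _)).ne')
    exact (((hZlim.log (integral_exp_pos hexp).ne').const_mul k).const_mul t).rexp
  have hpt : ∀ᵐ ω ∂(M.initLaw ν), ENNReal.ofReal (Real.exp (M.pathIntegral V 0 t ω)) =
      liminf (fun n => ENNReal.ofReal (Real.exp (M.pathIntegral (W n) 0 t ω))) atTop := by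
    filter_upwards [hμ.ae_intervalIntegrable_path hν hV hInt ht] with ω hω
    refine (Tendsto.liminf_eq (ENNReal.tendsto_ofReal (Tendsto.rexp ?_))).symm
    refine intervalIntegral.tendsto_integral_filter_of_dominated_convergence
      (fun s => |V (M.X s.toNNReal ω)|) (Eventually.of_forall fun n =>
        ((M.measurable_path (hW n)).comp measurable_prodMk_right).aestronglyMeasurable)
      (Eventually.of_forall fun n => Eventually.of_forall fun s _ => hWV n _) hω.abs
      (Eventually.of_forall fun s _ => hWlim _)
  rw [lintegral_congr_ae hpt]
  refine (lintegral_liminf_le fun n =>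
    (measurable_pathIntegral (hW n) 0 t).exp.ennreal_ofReal).trans ?_
  rw [← hlim.liminf_eq]
  exact liminf_le_liminf (Eventually.of_forall fun n =>
    hSob.lintegral_exp_pathIntegral_le hk hF hμ hν (hW n) (hB n) ht)

theorem FSobolev.initLaw_le [IsProbabilityMeasure μ]
    [IsProbabilityMeasure ν] (hSob : M.FSobolev μ F) (hk : 0 < k)
    (hF : ∀ x, 0 < x → F x = k * Real.log x) (hμ : M.IsInvariant μ) (hν : ν ≪ μ)
    (hV : Measurable V) (hInt : Integrable V μ) {t : ℝ} (ht : 0 < t) (a : ℝ) {c : ℝ} (hc : 0 ≤ c) :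
    M.initLaw ν {ω | a ≤ M.timeAverage V t ω} ≤ densityNorm ν μ * EReal.exp
      (-((t : EReal) * (((c * a : ℝ) : EReal) - sobolevFunctional μ F (fun x => c * V x)))) := by
  by_cases hexp : Integrable (fun x => Real.exp (c * V x / k)) μ
  · rw [sobolevFunctional_eq hk hF hexp, ← EReal.coe_sub, ← EReal.coe_mul, ← EReal.coe_neg,
      EReal.exp_coe]
    set S := k * Real.log (∫ x, Real.exp (c * V x / k) ∂μ) with hS
    have h1 := hSob.lintegral_exp_mul_pathIntegral_le hk hF hμ hν (hV.const_mul c)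
      (hInt.const_mul c) hexp ht.le
    have hm : Measurable fun ω =>
        ENNReal.ofReal (Real.exp (M.pathIntegral (fun x => c * V x) 0 t ω)) :=
      (measurable_pathIntegral (hV.const_mul c) 0 t).exp.ennreal_ofReal
    have h2 := (mul_meas_ge_le_lintegral (μ := M.initLaw ν) hm
      (ENNReal.ofReal (Real.exp (t * (c * a))))).trans h1
    have hsub : {ω | a ≤ M.timeAverage V t ω} ⊆ {ω | ENNReal.ofReal (Real.exp (t * (c * a))) ≤
        ENNReal.ofReal (Real.exp (M.pathIntegral (fun x => c * V x) 0 t ω))} := fun ω hω => by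
      refine ENNReal.ofReal_le_ofReal (Real.exp_le_exp.mpr ?_)
      have e1 : M.pathIntegral (fun x => c * V x) 0 t ω = t * (c * M.timeAverage V t ω) := by
        rw [pathIntegral, intervalIntegral.integral_const_mul, timeAverage]
        field_simp
      rw [e1]
      exact mul_le_mul_of_nonneg_left (mul_le_mul_of_nonneg_left hω hc) ht.le
    have e2 : Real.exp (t * S) = Real.exp (-(t * (c * a - S))) * Real.exp (t * (c * a)) := by
      rw [← Real.exp_add]; congr 1; ring
    rw [← hS, e2, ENNReal.ofReal_mul (Real.exp_pos _).le,
      ← mul_assoc (densityNorm ν μ), mul_comm (ENNReal.ofReal (Real.exp (t * (c * a))))] at h2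
    exact (measure_mono hsub).trans ((ENNReal.mul_le_mul_iff_left
      (ENNReal.ofReal_pos.mpr (Real.exp_pos _)).ne' ENNReal.ofReal_ne_top).mp h2)
  -- Without exponential integrability the bound reads `+∞`; the norm being nonzero rules out `0 * ∞
  -- = 0`.
  · rw [sobolevFunctional_eq_top hk hF (hV.const_mul c) hexp, EReal.sub_top,
      EReal.coe_mul_bot_of_pos ht, EReal.neg_bot, EReal.exp_top,
      ENNReal.mul_top (densityNorm_ne_zero hν)]
    exact le_top

theorem FSobolev.initLaw_le_Hstar [IsProbabilityMeasure μ]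
    [IsProbabilityMeasure ν] (hSob : M.FSobolev μ F) (hk : 0 < k)
    (hF : ∀ x, 0 < x → F x = k * Real.log x) (hμ : M.IsInvariant μ) (hν : ν ≪ μ)
    (hV : Measurable V) (hInt : Integrable V μ) {t : ℝ} (ht : 0 < t) (a : ℝ) :
    M.initLaw ν {ω | a ≤ M.timeAverage V t ω} ≤
      densityNorm ν μ * EReal.exp (-((t : EReal) * Hstar μ F V a)) := by
  by_cases hD : densityNorm ν μ = ∞
  -- Here the bound reads `∞ * 0 = 0`, so the event must be null. The case `ν = μ`, where the norm
  -- is `1`, shows this for `ℙ_μ`, and `ℙ_ν ≪ ℙ_μ`.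
  · by_cases hH : Hstar μ F V a = ⊤
    · have h1 : M.initLaw μ {ω | a ≤ M.timeAverage V t ω} ≤
          densityNorm μ μ * EReal.exp (-((t : EReal) * Hstar μ F V a)) :=
        ENNReal.le_mul_exp_neg_mul_iSup₂ ht (by simp [densityNorm_self])
          (by simp [densityNorm_self]) fun c hc =>
            hSob.initLaw_le hk hF hμ Measure.AbsolutelyContinuous.rfl hV hInt ht a hc.1
      rw [hH, EReal.coe_mul_top_of_pos ht, EReal.neg_top, EReal.exp_bot, mul_zero] at h1
      have hac : M.initLaw ν ≪ M.initLaw μ := hν.comp_right M.law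
      rw [hac (le_zero_iff.mp h1)]
      exact zero_le
    · rw [hD, ENNReal.top_mul]
      · exact le_top
      · rw [Ne, EReal.exp_eq_zero_iff, EReal.neg_eq_bot_iff]
        generalize Hstar μ F V a = H at hH
        induction H with
        | bot => simp [EReal.coe_mul_bot_of_pos ht]
        | top => exact absurd rfl hH
        | coe r => exact EReal.coe_ne_top (t * r)
  · exact ENNReal.le_mul_exp_neg_mul_iSup₂ ht (densityNorm_ne_zero hν) hD fun c hc =>
      hSob.initLaw_le hk hF hμ hν hV hInt ht a hc.1

end MarkovProcess

theorem mainTheorem1 {E Ω : Type*} [TopologicalSpace E] [PolishSpace E] [MeasurableSpace E]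
    [BorelSpace E] [MeasurableSpace Ω]
    (M : MarkovProcess E Ω) (μ : Measure E) [IsProbabilityMeasure μ] (hμ : M.IsInvariant μ)
    (F : ℝ → ℝ) (hF_cont : ContinuousOn F (Ioi 0)) (hF_mono : StrictMonoOn F (Ioi 0))
    (hF_conc : ConcaveOn ℝ (Ioi 0) F) (hF_top : Tendsto F atTop atTop) (hF_one : F 1 = 0)
    (hF_sub : ∀ x y : ℝ, 0 < x → 0 < y → F (x * y) ≤ F x + F y)
    (hSob : M.FSobolev μ F)
    (V : E → ℝ) (hV_meas : Measurable V) (hV_int : Integrable V μ) :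
    -- the two deviation bounds
    (∀ (ν : Measure E) [IsProbabilityMeasure ν], ν ≪ μ → ∀ t : ℝ, 0 < t → ∀ R : ℝ, 0 < R →
      M.initLaw ν {ω | R ≤ M.timeAverage V t ω - ∫ x, V x ∂μ}
          ≤ densityNorm ν μ * EReal.exp (-((t : EReal) * Hstar μ F V (R + ∫ x, V x ∂μ))) ∧
      M.initLaw ν {ω | R ≤ M.timeAverage V t ω - ∫ x, V x ∂μ}
          ≤ densityNorm ν μ * EReal.exp (-((t : EReal) * HstarC μ F V R))) ∧
    -- the second one is at least as good as the first one when `F(0) = -∞`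
    (valueAtZero F = ⊥ → ∀ R : ℝ, 0 < R → Hstar μ F V (R + ∫ x, V x ∂μ) ≤ HstarC μ F V R) ∧
    -- the bound on `Λ(λ V)`
    (∀ c : ℝ, 0 ≤ c → (c : EReal) < lambdaMax μ F V →
      M.Lam μ (fun x => c * V x) ≤ sobolevFunctional μ F (fun x => c * V x)) := by
  obtain ⟨k, hk, hF⟩ := exists_eq_mul_log hF_mono hF_conc hF_one hF_sub
  have hbound : ∀ (ν : Measure E) [IsProbabilityMeasure ν], ν ≪ μ → ∀ t : ℝ, 0 < t → ∀ R : ℝ,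
      M.initLaw ν {ω | R ≤ M.timeAverage V t ω - ∫ x, V x ∂μ}
        ≤ densityNorm ν μ * EReal.exp (-((t : EReal) * Hstar μ F V (R + ∫ x, V x ∂μ))) := by
    intro ν _ hν t ht R
    simp_rw [le_sub_iff_add_le]
    exact hSob.initLaw_le_Hstar hk hF hμ hν hV_meas hV_int ht _
  refine ⟨fun ν _ hν t ht R _ => ⟨hbound ν hν t ht R, ?_⟩, fun _ R _ => ?_, fun c _ _ => ?_⟩
  · rw [HstarC_eq_Hstar hk hF hV_meas]
    exact hbound ν hν t ht R
  · exact (HstarC_eq_Hstar hk hF hV_meas R).ge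
  · exact hSob.Lam_le hk hF (hV_meas.const_mul c)
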